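/- **Setting.** Let $U$ and $V$ be the finite sets of convolutional and fully connected layers of a network. Let $W=(W^{(u)})_{u\in U\cup V}$ stack all weights, $n$ in total, with the Euclidean norm, and let $\|W^{(u)}\|_0$ be the number of nonzero entries of $W^{(u)}$. Let $k\ge 1$ be an integer and let $\alpha_1^{(u)},\dots,\alpha_4^{(u)}\ge 0$ be reals with $\alpha_1^{(u)}\le\alpha_2^{(u)}$. For a real $E$ put $$\Omega(E)=\Big\{W \;\Big|\; \sum_{u\in U\cup V}\alpha_1^{(u)}\min(k,\|W^{(u)}\|_0)+\alpha_2^{(u)}\max(0,\|W^{(u)}\|_0-k)+\alpha_3^{(u)}\|W^{(u)}\|_0+\alpha_4^{(u)}\le E\Big\}.$$ Given $Z$ and a budget $E_{\rm budget}$ with $\Omega(E_{\rm budget})\neq\emptyset$, the projection problem asks for $P_{\Omega(E_{\rm budget})}(Z)\in\operatorname{argmin}_{W\in\Omega(E_{\rm budget})}\|W-Z\|^2$. Let $A^{(u)}_j=\alpha^{(u)}_1+\alpha^{(u)}_3$ if $Z^{(u)}_j$ is among the $k$ entries of $Z^{(u)}$ of largest magnitude (ties broken by position) and $A^{(u)}_j=\alpha^{(u)}_2+\alpha^{(u)}_3$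 otherwise. Let $\max(A)$ be the largest entry of $A$ and $\min(A_+)$ the smallest positive one. **Theorem.** There are one algorithm (a program of a real random access machine, which charges one step for each assignment, branching, memory access, comparison, field operation on reals, and addition or subtraction of indices, and has no rounding operation) and absolute constants $c,C>0$ such that the following holds for every projection problem as above and every $\varepsilon\in(0,1]$. On input of the problem and $\varepsilon$, the algorithm halts and outputs a point $W'\in\Omega(E_{\rm budget})$ such that $$\|W'-Z\|^2\le\Big\|P_{\Omega\left(\frac{E_{\rm budget}}{1+c\varepsilon}\right)}(Z)-Z\Big\|^2$$ for every projection of $Z$ onto $\Omega\big(E_{\rm budget}/(1+c\varepsilon)\big)$ (if this set is empty, nothing is claimed about the distance). If moreover $n\ge 2$ and $A$ has a positive entry, then the number of steps is at most $$C\left(n+\frac{(|U|+|V|)^3}{\varepsilon^2}\right)\log\frac{n\max(A)}{\min(A_+)}.$$ In particular, when $n\ge2$ and $A$ has a positive entry, it is at most $D_{|U|+|V|}\left(n+\frac1{\varepsilon^2}\right)\log\frac{n\max(A)}{\min(A_+)}$, where $D_{|U|+|V|}$ depends only on the number of layers; that is, it is $\tilde O(n+1/\varepsilon^2)$ when the number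 of layers is treated as a constant and the logarithm is omitted. -/

import Mathlib

/-! ### A real random access machine

Two kinds of memory cells, holding natural numbers (indices, counters) and real numbers, are
organised in arrays with natural-number addresses.  Cells can be addressed indirectly.  The
operations on naturals are addition and truncated subtraction, those on reals are the four field
operations; both kinds can be compared.  There is no rounding and no conversion from reals to
naturals.  A program is a fixed finite object: it names finitely many arrays and its only
constants are natural and rational literals.  Every node of every expression that is evaluated,
every assignment and every branching costs one step. -/

namespace RealRAM

/-- The memory: cell `i` of the natural-number array `a` is `nat a i`, and cell `i` of the
real array `a` is `real a i`. -/
structure Memory where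
  nat : ℕ → ℕ → ℕ
  real : ℕ → ℕ → ℝ

/-- Expressions with natural-number values. -/
inductive NatExpr where
  | lit (c : ℕ)
  | get (a : ℕ) (i : NatExpr)
  | add (e f : NatExpr)
  | sub (e f : NatExpr)

/-- Expressions with real values. -/
inductive RealExpr where
  | lit (q : ℚ)
  | get (a : ℕ) (i : NatExpr)
  | add (e f : RealExpr)
  | sub (e f : RealExpr)
  | mul (e f : RealExpr)
  | div (e f : RealExpr)

/-- Tests. -/
inductive Test where
  | natLe (e f : NatExpr)
  | realLe (e f : RealExpr)
  | not (b : Test)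
  | and (b c : Test)

/-- Programs. -/
inductive Prog where
  | skip
  | setNat (a : ℕ) (i e : NatExpr)
  | setReal (a : ℕ) (i : NatExpr) (e : RealExpr)
  | seq (p q : Prog)
  | ite (b : Test) (p q : Prog)
  | loop (b : Test) (p : Prog)

namespace NatExpr

/-- Value of an expression. -/
def eval (σ : Memory) : NatExpr → ℕ
  | lit c => c
  | get a i => σ.nat a (i.eval σ)
  | add e f => e.eval σ + f.eval σ
  | sub e f => e.eval σ - f.eval σ

/-- Number of steps that the evaluation takes. -/
def cost : NatExpr → ℕ
  | lit _ => 1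
  | get _ i => i.cost + 1
  | add e f => e.cost + f.cost + 1
  | sub e f => e.cost + f.cost + 1

end NatExpr

namespace RealExpr

/-- Value of an expression (a division by zero returns zero). -/
noncomputable def eval (σ : Memory) : RealExpr → ℝ
  | lit q => (q : ℝ)
  | get a i => σ.real a (i.eval σ)
  | add e f => e.eval σ + f.eval σ
  | sub e f => e.eval σ - f.eval σ
  | mul e f => e.eval σ * f.eval σ
  | div e f => e.eval σ / f.eval σ

/-- Number of steps that the evaluation takes. -/
def cost : RealExpr → ℕ
  | lit _ => 1
  | get _ i => i.cost + 1
  | add e f => e.cost + f.cost + 1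
  | sub e f => e.cost + f.cost + 1
  | mul e f => e.cost + f.cost + 1
  | div e f => e.cost + f.cost + 1

end RealExpr

namespace Test

/-- Truth of a test. -/
def Holds (σ : Memory) : Test → Prop
  | natLe e f => e.eval σ ≤ f.eval σ
  | realLe e f => e.eval σ ≤ f.eval σ
  | not b => ¬ b.Holds σ
  | and b c => b.Holds σ ∧ c.Holds σ

/-- Number of steps that the evaluation takes. -/
def cost : Test → ℕ
  | natLe e f => e.cost + f.cost + 1
  | realLe e f => e.cost + f.cost + 1
  | not b => b.cost + 1
  | and b c => b.cost + c.cost + 1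

end Test

namespace Memory

/-- Write `v` into cell `i` of the natural-number array `a`. -/
def writeNat (σ : Memory) (a i v : ℕ) : Memory where
  nat := fun a' i' => if a' = a ∧ i' = i then v else σ.nat a' i'
  real := σ.real

/-- Write `v` into cell `i` of the real array `a`. -/
def writeReal (σ : Memory) (a i : ℕ) (v : ℝ) : Memory where
  nat := σ.nat
  real := fun a' i' => if a' = a ∧ i' = i then v else σ.real a' i'

end Memory

/-- `Run p σ t τ`: started in memory `σ`, the program `p` halts after exactly `t` steps,
and then the memory is `τ`. -/
inductive Run : Prog → Memory → ℕ → Memory → Prop where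
  | skip (σ : Memory) : Run .skip σ 1 σ
  | setNat (a : ℕ) (i e : NatExpr) (σ : Memory) :
      Run (.setNat a i e) σ (i.cost + e.cost + 1) (σ.writeNat a (i.eval σ) (e.eval σ))
  | setReal (a : ℕ) (i : NatExpr) (e : RealExpr) (σ : Memory) :
      Run (.setReal a i e) σ (i.cost + e.cost + 1) (σ.writeReal a (i.eval σ) (e.eval σ))
  | seq {p q : Prog} {σ τ ρ : Memory} {s t : ℕ} :
      Run p σ s τ → Run q τ t ρ → Run (.seq p q) σ (s + t) ρ
  | iteTrue {b : Test} {p q : Prog} {σ τ : Memory} {t : ℕ} :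
      b.Holds σ → Run p σ t τ → Run (.ite b p q) σ (b.cost + 1 + t) τ
  | iteFalse {b : Test} {p q : Prog} {σ τ : Memory} {t : ℕ} :
      ¬ b.Holds σ → Run q σ t τ → Run (.ite b p q) σ (b.cost + 1 + t) τ
  | loopDone {b : Test} {p : Prog} {σ : Memory} :
      ¬ b.Holds σ → Run (.loop b p) σ (b.cost + 1) σ
  | loopStep {b : Test} {p : Prog} {σ τ ρ : Memory} {s t : ℕ} :
      b.Holds σ → Run p σ s τ → Run (.loop b p) τ t ρ →
      Run (.loop b p) σ (b.cost + 1 + s + t) ρ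

/-- The machine is deterministic: running time and final memory are determined. -/
theorem Run.det {p : Prog} {σ τ τ' : Memory} {t t' : ℕ}
    (h : Run p σ t τ) (h' : Run p σ t' τ') : t = t' ∧ τ = τ' := by
  induction h generalizing t' τ' with
  | skip σ => cases h'; exact ⟨rfl, rfl⟩
  | setNat a i e σ => cases h'; exact ⟨rfl, rfl⟩
  | setReal a i e σ => cases h'; exact ⟨rfl, rfl⟩
  | seq _ _ ih1 ih2 =>
    cases h' with
    | seq h1 h2 =>
      obtain ⟨rfl, rfl⟩ := ih1 h1
      obtain ⟨rfl, rfl⟩ := ih2 h2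
      exact ⟨rfl, rfl⟩
  | iteTrue hb _ ih =>
    cases h' with
    | iteTrue _ h1 =>
      obtain ⟨rfl, rfl⟩ := ih h1
      exact ⟨rfl, rfl⟩
    | iteFalse hb' _ => exact absurd hb hb'
  | iteFalse hb _ ih =>
    cases h' with
    | iteTrue hb' _ => exact absurd hb' hb
    | iteFalse _ h1 =>
      obtain ⟨rfl, rfl⟩ := ih h1
      exact ⟨rfl, rfl⟩
  | loopDone hb =>
    cases h' with
    | loopDone _ => exact ⟨rfl, rfl⟩
    | loopStep hb' _ _ => exact absurd hb' hb
  | loopStep hb _ _ ih1 ih2 =>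
    cases h' with
    | loopDone hb' => exact absurd hb hb'
    | loopStep _ h1 h2 =>
      obtain ⟨rfl, rfl⟩ := ih1 h1
      obtain ⟨rfl, rfl⟩ := ih2 h2
      exact ⟨rfl, rfl⟩

end RealRAM

/-! ### The energy-constrained projection problem -/

/-- Data of a projection problem: `numConv = |U|` convolutional layers and `numFC = |V|` fully
connected layers, the number `size u` of weights of each layer `u ∈ U ∪ V`, the constants of the
energy model, the energy budget, and the point `Z` to be projected. -/
structure EnergyProblem where
  numConv : ℕ
  numFC : ℕ
  size : Fin (numConv + numFC) → ℕ
  k : ℕ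
  k_pos : 0 < k
  α₁ : Fin (numConv + numFC) → ℝ
  α₂ : Fin (numConv + numFC) → ℝ
  α₃ : Fin (numConv + numFC) → ℝ
  α₄ : Fin (numConv + numFC) → ℝ
  α₁_nonneg : ∀ u, 0 ≤ α₁ u
  α₁_le_α₂ : ∀ u, α₁ u ≤ α₂ u
  α₃_nonneg : ∀ u, 0 ≤ α₃ u
  α₄_nonneg : ∀ u, 0 ≤ α₄ u
  budget : ℝ
  Z : EuclideanSpace ℝ ((u : Fin (numConv + numFC)) × Fin (size u))

namespace EnergyProblem

variable (P : EnergyProblem)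

/-- The layers, i.e. the elements of `U ∪ V`. -/
abbrev Layer : Type := Fin (P.numConv + P.numFC)

/-- Positions of the individual weights: a layer and a position in that layer. -/
abbrev Idx : Type := (u : P.Layer) × Fin (P.size u)

/-- The space of all weights, with the Euclidean norm. -/
abbrev Weights : Type := EuclideanSpace ℝ P.Idx

/-- The total number of weights. -/
def n : ℕ := ∑ u, P.size u

/-- `‖W⁽ᵘ⁾‖₀`, the number of nonzero weights in layer `u`. -/
noncomputable def l0 (W : P.Weights) (u : P.Layer) : ℕ :=
  (Finset.univ.filter fun j : Fin (P.size u) => W ⟨u, j⟩ ≠ 0).card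

/-- The energy of the weights `W`. -/
noncomputable def energy (W : P.Weights) : ℝ :=
  ∑ u, (P.α₁ u * min (P.k : ℝ) (P.l0 W u) + P.α₂ u * max 0 ((P.l0 W u : ℝ) - P.k)
    + P.α₃ u * P.l0 W u + P.α₄ u)

/-- The constraint set `Ω(E)`. -/
def Omega (E : ℝ) : Set P.Weights := {W | P.energy W ≤ E}

/-- `Q` is a projection of `Z` onto `S`: a minimizer of `‖W - Z‖²` over `W ∈ S`. -/
def IsProjection (S : Set P.Weights) (Q : P.Weights) : Prop :=
  Q ∈ S ∧ ∀ W ∈ S, ‖Q - P.Z‖ ^ 2 ≤ ‖W - P.Z‖ ^ 2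

/-- The weight at position `x` is among the top `k` weights of its layer in `Z` in terms of
magnitude (ties are broken by position). -/
def IsTop (x : P.Idx) : Prop :=
  (Finset.univ.filter fun i : Fin (P.size x.1) =>
    |P.Z x| < |P.Z ⟨x.1, i⟩| ∨ (|P.Z ⟨x.1, i⟩| = |P.Z x| ∧ i < x.2)).card < P.k

open Classical in
/-- The knapsack weight of the position `x`. -/
noncomputable def A (x : P.Idx) : ℝ :=
  if P.IsTop x then P.α₁ x.1 + P.α₃ x.1 else P.α₂ x.1 + P.α₃ x.1

/-- The largest element of `A`. -/
noncomputable def maxA : ℝ := ⨆ x, P.A x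

/-- The smallest positive element of `A`, if there is one. -/
noncomputable def minPosA : ℝ := sInf {a | 0 < a ∧ ∃ x, P.A x = a}

/-- The memory at the start: the problem and the accuracy `ε`.  The entries of `Z` are stored
layer by layer in one array; cells that hold no input are zero. -/
noncomputable def input (ε : ℝ) : RealRAM.Memory where
  nat
    | 0, 0 => P.numConv
    | 0, 1 => P.numFC
    | 0, 2 => P.k
    | 1, i => if h : i < P.numConv + P.numFC then P.size ⟨i, h⟩ else 0
    | _, _ => 0
  real
    | 0, 0 => P.budget
    | 0, 1 => ε
    | 1, i => if h : i < ∑ u, P.size u then P.Z (finSigmaFinEquiv.symm ⟨i, h⟩) else 0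
    | 2, i => if h : i < P.numConv + P.numFC then P.α₁ ⟨i, h⟩ else 0
    | 3, i => if h : i < P.numConv + P.numFC then P.α₂ ⟨i, h⟩ else 0
    | 4, i => if h : i < P.numConv + P.numFC then P.α₃ ⟨i, h⟩ else 0
    | 5, i => if h : i < P.numConv + P.numFC then P.α₄ ⟨i, h⟩ else 0
    | _, _ => 0

/-- The weights that a final memory stores in the output array (real array `6`), layer by
layer. -/
noncomputable def output (σ : RealRAM.Memory) : P.Weights :=
  WithLp.toLp 2 fun x => σ.real 6 (finSigmaFinEquiv x : Fin (∑ u, P.size u))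

/-- A projection exists as soon as the constraint set is nonempty. -/
theorem exists_isProjection {E : ℝ} (h : (P.Omega E).Nonempty) :
    ∃ Q, P.IsProjection (P.Omega E) Q := by
  classical
  let r : Finset P.Idx → P.Weights := fun S =>
    WithLp.toLp 2 fun x => if x ∈ S then P.Z x else 0
  have key : ∀ W ∈ P.Omega E, ∃ S, r S ∈ P.Omega E ∧ ‖r S - P.Z‖ ^ 2 ≤ ‖W - P.Z‖ ^ 2 := by
    intro W hW
    refine ⟨Finset.univ.filter fun x => W x ≠ 0, ?_, ?_⟩
    · have hW' : P.energy W ≤ E := hW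
      refine le_trans (b := P.energy W) ?_ hW'
      refine Finset.sum_le_sum fun u _ => ?_
      have hc : P.l0 (r (Finset.univ.filter fun x => W x ≠ 0)) u ≤ P.l0 W u := by
        refine Finset.card_le_card fun j hj => ?_
        simp only [Finset.mem_filter, Finset.mem_univ, true_and, r] at hj ⊢
        intro h0
        simp [h0] at hj
      have hc' : (P.l0 (r (Finset.univ.filter fun x => W x ≠ 0)) u : ℝ) ≤ P.l0 W u := by
        exact_mod_cast hc
      have h1 := P.α₁_nonneg u
      have h2 := h1.trans (P.α₁_le_α₂ u)
      have h3 := P.α₃_nonneg u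
      gcongr
    · rw [EuclideanSpace.norm_sq_eq, EuclideanSpace.norm_sq_eq]
      refine Finset.sum_le_sum fun x _ => ?_
      by_cases h0 : W x = 0 <;> simp [r, h0]
      positivity
  obtain ⟨W₀, hW₀⟩ := h
  obtain ⟨S₀, hS₀, -⟩ := key W₀ hW₀
  obtain ⟨S, hS, hmin⟩ := (Finset.univ.filter fun S => r S ∈ P.Omega E).exists_min_image
    (fun S => ‖r S - P.Z‖ ^ 2) ⟨S₀, by simpa using hS₀⟩
  refine ⟨r S, by simpa using hS, fun W hW => ?_⟩
  obtain ⟨T, hT, hle⟩ := key W hW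
  exact (hmin T (by simpa using hT)).trans hle

end EnergyProblem

/-!
The projection keeps some of the weights of `Z` and sets the others to zero. The energy of a layer
depends only on the number `c` of nonzero weights and grows with `c`, so in every layer it is
best to keep the `c` weights of largest magnitude, and the problem is to choose one count per layer
so that the energies of the layers fit into the capacity `B`, the budget minus the fixed costs `α₄`.

The algorithm divides `B` into `Q = 1 + L (⌈1/ε⌉ + 1)` equal quanta, where `L` is the number of
layers. It sorts each layer by merge sort (`sortLayer_spec`), finds for every `q ≤ Q` the largest
count that `q` quanta can pay (`scanLayer_spec`), and distributes the `Q` quanta among the layers by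
dynamic programming (`tableRow_spec`); following the recorded choices backwards gives the output
(`traceLoop_spec`). The output respects the budget exactly, because a layer that is given `q` quanta
spends at most `q B / Q`. It is as good as every competitor with energy at most `B / (1 + ε)`:
rounding the energies of the competitor up to whole quanta costs less than one quantum per layer, and
`L ≤ Q ε / (1 + ε)` quanta are to spare (`sum_layerGain_le_of_slack`). The constant of the theorem is
thus `c = 1`.

Sorting costs `O(n log n)` steps. The dynamic program computes `L` rows of `Q + 1` entries with
`O(Q)` steps each, which amounts to `O(L³ / ε²)` (`programTime_le_log`). Multiplications by `Q` take
the place of divisions by `B`, so a capacity of zero needs no special treatment.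

Programs are verified with statements `Exec p σ T Post`: started in `σ`, the program `p` halts within
`T` steps in a memory that satisfies `Post`. Which arrays a program can change is read off its text
(`Run.frame`), and programs without loops are evaluated symbolically (`Exec.loopFree`).
-/

namespace RealRAM

/-! ### Running time and frame rules for machine programs -/

infixr:60 " ;; " => Prog.seq

/-- A natural-number variable: cell `0` of the array `a`. -/
abbrev NatExpr.var (a : ℕ) : NatExpr := .get a (.lit 0)

/-- A real variable: cell `0` of the array `a`. -/
abbrev RealExpr.var (a : ℕ) : RealExpr := .get a (.lit 0)

/-- Assignment to a natural-number variable. -/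
abbrev Prog.letNat (a : ℕ) (e : NatExpr) : Prog := .setNat a (.lit 0) e

/-- Assignment to a real variable. -/
abbrev Prog.letReal (a : ℕ) (e : RealExpr) : Prog := .setReal a (.lit 0) e

/-- Strict comparison of natural numbers. -/
abbrev Test.natLt (e f : NatExpr) : Test := .not (.natLe f e)

@[simp] theorem Memory.writeNat_nat (σ : Memory) (a i v b j : ℕ) :
    (σ.writeNat a i v).nat b j = if b = a ∧ j = i then v else σ.nat b j := rfl

@[simp] theorem Memory.writeNat_nat_of_ne (σ : Memory) {a b : ℕ} (i v : ℕ) (h : b ≠ a) :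
    (σ.writeNat a i v).nat b = σ.nat b := by
  funext j
  simp [h]

@[simp] theorem Memory.writeNat_real (σ : Memory) (a i v : ℕ) :
    (σ.writeNat a i v).real = σ.real := rfl

@[simp] theorem Memory.writeReal_nat (σ : Memory) (a i : ℕ) (v : ℝ) :
    (σ.writeReal a i v).nat = σ.nat := rfl

@[simp] theorem Memory.writeReal_real (σ : Memory) (a i : ℕ) (v : ℝ) (b j : ℕ) :
    (σ.writeReal a i v).real b j = if b = a ∧ j = i then v else σ.real b j := rfl

@[simp] theorem Memory.writeReal_real_of_ne (σ : Memory) {a b : ℕ} (i : ℕ) (v : ℝ)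
    (h : b ≠ a) : (σ.writeReal a i v).real b = σ.real b := by
  funext j
  simp [h]

namespace Prog

/-- The natural-number arrays that a program may write to. -/
def natWrites : Prog → List ℕ
  | skip => []
  | setNat a _ _ => [a]
  | setReal _ _ _ => []
  | seq p q => p.natWrites ++ q.natWrites
  | ite _ p q => p.natWrites ++ q.natWrites
  | loop _ p => p.natWrites

/-- The real arrays that a program may write to. -/
def realWrites : Prog → List ℕ
  | skip => []
  | setNat _ _ _ => []
  | setReal a _ _ => [a]
  | seq p q => p.realWrites ++ q.realWrites
  | ite _ p q => p.realWrites ++ q.realWrites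
  | loop _ p => p.realWrites

/-- The memories `σ` and `τ` agree on all arrays that `p` does not write to.  Array names are
literals, so membership in the lists of written arrays is decidable by evaluation. -/
def Frame (p : Prog) (σ τ : Memory) : Prop :=
  (∀ a, a ∉ p.natWrites → τ.nat a = σ.nat a) ∧ (∀ a, a ∉ p.realWrites → τ.real a = σ.real a)

theorem Frame.refl (p : Prog) (σ : Memory) : p.Frame σ σ :=
  ⟨fun _ _ => rfl, fun _ _ => rfl⟩

theorem Frame.trans {p : Prog} {σ τ ρ : Memory} (h : p.Frame σ τ) (h' : p.Frame τ ρ) :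
    p.Frame σ ρ :=
  ⟨fun a ha => (h'.1 a ha).trans (h.1 a ha), fun a ha => (h'.2 a ha).trans (h.2 a ha)⟩

theorem Frame.mono {p q : Prog} {σ τ : Memory} (h : p.Frame σ τ)
    (hn : p.natWrites ⊆ q.natWrites) (hr : p.realWrites ⊆ q.realWrites) : q.Frame σ τ :=
  ⟨fun a ha => h.1 a fun h' => ha (hn h'), fun a ha => h.2 a fun h' => ha (hr h')⟩

/-- A program without loops. -/
def LoopFree : Prog → Bool
  | skip => true
  | setNat _ _ _ => true
  | setReal _ _ _ => true
  | seq p q => p.LoopFree && q.LoopFree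
  | ite _ p q => p.LoopFree && q.LoopFree
  | loop _ _ => false

/-- A bound on the running time of a program without loops. -/
def maxCost : Prog → ℕ
  | skip => 1
  | setNat _ i e => i.cost + e.cost + 1
  | setReal _ i e => i.cost + e.cost + 1
  | seq p q => p.maxCost + q.maxCost
  | ite b p q => b.cost + 1 + (p.maxCost + q.maxCost)
  | loop _ _ => 0

open Classical in
/-- The effect of a program without loops (a loop is treated as having no effect). -/
noncomputable def eval : Prog → Memory → Memory
  | skip, σ => σ
  | setNat a i e, σ => σ.writeNat a (i.eval σ) (e.eval σ)
  | setReal a i e, σ => σ.writeReal a (i.eval σ) (e.eval σ)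
  | seq p q, σ => q.eval (p.eval σ)
  | ite b p q, σ => if b.Holds σ then p.eval σ else q.eval σ
  | loop _ _, σ => σ

theorem eval_seq (p q : Prog) (σ : Memory) : (p ;; q).eval σ = q.eval (p.eval σ) := rfl

theorem eval_ite_pos {b : Test} {p q : Prog} {σ : Memory} (h : b.Holds σ) :
    (ite b p q).eval σ = p.eval σ := if_pos h

theorem eval_ite_neg {b : Test} {p q : Prog} {σ : Memory} (h : ¬ b.Holds σ) :
    (ite b p q).eval σ = q.eval σ := if_neg h

theorem run_eval (p : Prog) (σ : Memory) (h : p.LoopFree = true) :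
    ∃ t ≤ p.maxCost, Run p σ t (p.eval σ) := by
  induction p generalizing σ with
  | skip => exact ⟨1, le_rfl, .skip σ⟩
  | setNat a i e => exact ⟨_, le_rfl, .setNat a i e σ⟩
  | setReal a i e => exact ⟨_, le_rfl, .setReal a i e σ⟩
  | seq p q hp hq =>
    simp only [LoopFree, Bool.and_eq_true] at h
    obtain ⟨s, hs, hs'⟩ := hp σ h.1
    obtain ⟨t, ht, ht'⟩ := hq (p.eval σ) h.2
    exact ⟨s + t, Nat.add_le_add hs ht, .seq hs' ht'⟩
  | ite b p q hp hq =>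
    simp only [LoopFree, Bool.and_eq_true] at h
    by_cases hb : b.Holds σ
    · obtain ⟨s, hs, hs'⟩ := hp σ h.1
      refine ⟨b.cost + 1 + s, by simp only [maxCost]; omega, ?_⟩
      rw [eval, if_pos hb]
      exact .iteTrue hb hs'
    · obtain ⟨s, hs, hs'⟩ := hq σ h.2
      refine ⟨b.cost + 1 + s, by simp only [maxCost]; omega, ?_⟩
      rw [eval, if_neg hb]
      exact .iteFalse hb hs'
  | loop b p _ => simp [LoopFree] at h

end Prog

/-- The frame rule: only the arrays named in assignments change. -/
theorem Run.frame {p : Prog} {σ τ : Memory} {t : ℕ} (h : Run p σ t τ) : p.Frame σ τ := by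
  induction h with
  | skip σ => exact .refl _ _
  | setNat a i e σ =>
    refine ⟨fun b hb => ?_, fun _ _ => rfl⟩
    funext j
    have hb' : b ≠ a := by simpa [Prog.natWrites] using hb
    simp [hb']
  | setReal a i e σ =>
    refine ⟨fun _ _ => rfl, fun b hb => ?_⟩
    funext j
    have hb' : b ≠ a := by simpa [Prog.realWrites] using hb
    simp [hb']
  | seq _ _ h1 h2 =>
    exact (h1.mono (by simp [Prog.natWrites]) (by simp [Prog.realWrites])).trans
      (h2.mono (by simp [Prog.natWrites]) (by simp [Prog.realWrites]))
  | iteTrue _ _ h => exact h.mono (by simp [Prog.natWrites]) (by simp [Prog.realWrites])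
  | iteFalse _ _ h => exact h.mono (by simp [Prog.natWrites]) (by simp [Prog.realWrites])
  | loopDone _ => exact .refl _ _
  | loopStep _ _ _ h1 h2 => exact Prog.Frame.trans ⟨h1.1, h1.2⟩ h2

/-- Started in `σ`, the program `p` halts within `T` steps in a memory satisfying `Post`. -/
def Exec (p : Prog) (σ : Memory) (T : ℕ) (Post : Memory → Prop) : Prop :=
  ∃ t τ, Run p σ t τ ∧ t ≤ T ∧ Post τ

namespace Exec

variable {p q : Prog} {b : Test} {σ : Memory} {S T : ℕ} {Post Post' : Memory → Prop}

theorem mono (h : Exec p σ S Post) (hT : S ≤ T)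
    (hP : ∀ τ, p.Frame σ τ → Post τ → Post' τ) : Exec p σ T Post' := by
  obtain ⟨t, τ, hr, ht, hτ⟩ := h
  exact ⟨t, τ, hr, ht.trans hT, hP τ hr.frame hτ⟩

theorem seq {Mid : Memory → Prop} (T₁ T₂ : ℕ) (h : Exec p σ T₁ Mid)
    (h' : ∀ τ, p.Frame σ τ → Mid τ → Exec q τ T₂ Post) (hT : T₁ + T₂ ≤ T) :
    Exec (p ;; q) σ T Post := by
  obtain ⟨s, τ, hr, hs, hτ⟩ := h
  obtain ⟨t, ρ, hr', ht, hρ⟩ := h' τ hr.frame hτ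
  exact ⟨s + t, ρ, .seq hr hr', by omega, hρ⟩

theorem loopFree (T : ℕ) (h : p.LoopFree = true) (hT : p.maxCost ≤ T) (hP : Post (p.eval σ)) :
    Exec p σ T Post := by
  obtain ⟨t, ht, hr⟩ := p.run_eval σ h
  exact ⟨t, _, hr, ht.trans hT, hP⟩

/-- Loops whose number of iterations is known: `I i` is the invariant after `i` iterations. -/
theorem loop_count (N : ℕ) (c : ℕ → ℕ) (I : ℕ → Memory → Prop) (h0 : I 0 σ)
    (hbody : ∀ i τ, i < N → (Prog.loop b p).Frame σ τ → I i τ →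
      b.Holds τ ∧ Exec p τ (c i) (I (i + 1)))
    (hend : ∀ τ, (Prog.loop b p).Frame σ τ → I N τ → ¬ b.Holds τ) :
    Exec (.loop b p) σ (∑ i ∈ Finset.range N, (c i + b.cost + 1) + (b.cost + 1)) (I N) := by
  induction N generalizing σ c I with
  | zero =>
    exact ⟨b.cost + 1, σ, .loopDone (hend σ (.refl _ _) h0), by simp, h0⟩
  | succ N ih =>
    obtain ⟨hb, s, τ, hr, hs, hτ⟩ := hbody 0 σ (Nat.succ_pos N) (.refl _ _) h0
    have hF : (Prog.loop b p).Frame σ τ := ⟨hr.frame.1, hr.frame.2⟩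
    obtain ⟨t, ρ, hr', ht, hρ⟩ := ih (σ := τ) (fun i => c (i + 1)) (fun i => I (i + 1)) hτ
      (fun i ρ hi hρ => hbody (i + 1) ρ (by omega) (hF.trans hρ))
      (fun ρ hρ => hend ρ (hF.trans hρ))
    refine ⟨_, ρ, .loopStep hb hr hr', ?_, hρ⟩
    rw [Finset.sum_range_succ']
    omega

/-- Loops whose number of iterations is known and whose body runs in bounded time. -/
theorem loop_const (N c : ℕ) (I : ℕ → Memory → Prop) (h0 : I 0 σ)
    (hbody : ∀ i τ, i < N → (Prog.loop b p).Frame σ τ → I i τ →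
      b.Holds τ ∧ Exec p τ c (I (i + 1)))
    (hend : ∀ τ, (Prog.loop b p).Frame σ τ → I N τ → ¬ b.Holds τ)
    (hT : N * (c + b.cost + 1) + (b.cost + 1) ≤ T) :
    Exec (.loop b p) σ T (I N) :=
  (loop_count N (fun _ => c) I h0 hbody hend).mono (by simpa using hT) fun _ _ h => h

/-- Loops with a potential `V` that pays for every iteration. -/
theorem loop_potential (V : Memory → ℕ) (I : Memory → Prop) (h0 : I σ)
    (hbody : ∀ τ, (Prog.loop b p).Frame σ τ → I τ → b.Holds τ →
      ∃ s, Exec p τ s (fun ρ => I ρ ∧ V ρ + (s + b.cost + 1) ≤ V τ))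
    (hT : V σ + (b.cost + 1) ≤ T) :
    Exec (.loop b p) σ T (fun τ => I τ ∧ ¬ b.Holds τ) := by
  induction hV : V σ using Nat.strong_induction_on generalizing σ T with
  | _ v ih =>
    by_cases hb : b.Holds σ
    · obtain ⟨s', s, τ, hr, hs, hτ, hlt⟩ := hbody σ (.refl _ _) h0 hb
      have hF : (Prog.loop b p).Frame σ τ := ⟨hr.frame.1, hr.frame.2⟩
      obtain ⟨t, ρ, hr', ht, hρ⟩ := ih (V τ) (by omega) (σ := τ) hτ
        (fun ρ hρ => hbody ρ (hF.trans hρ)) le_rfl rfl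
      exact ⟨_, ρ, .loopStep hb hr hr', by omega, hρ⟩
    · exact ⟨b.cost + 1, σ, .loopDone hb, by omega, h0, hb⟩

end Exec

/-! ### The program

The arrays of the program have the following numbers; the input occupies
the natural-number arrays `0` and `1` and the real arrays `0` to `5`, and `rOut` is the output.
Names that begin with `a` stand for arrays of natural numbers, names that begin with `v` for
natural-number variables, i.e. arrays of which only cell `0` is used, and names that begin with `r`
for real arrays and variables. The numbers of variables are at least `10`, where the initial
memory is zero. -/

notation "aPerm" => 2
notation "aBuffer" => 3
notation "aOrder" => 4
notation "aCount" => 5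
notation "aChoice" => 6
notation "vLayers" => 10
notation "vQuanta" => 11
notation "vGrain" => 12
notation "vLayer" => 13
notation "vOffset" => 14
notation "vRow" => 15
notation "vSize" => 16
notation "vRun" => 17
notation "vLo" => 18
notation "vMid" => 19
notation "vHi" => 20
notation "vLeft" => 21
notation "vRight" => 22
notation "vPos" => 23
notation "vLevel" => 24
notation "vShare" => 25
notation "vRest" => 26
notation "vNext" => 27
notation "rOut" => 6
notation "rTable" => 7
notation "rGain" => 8
notation "rCapacity" => 10
notation "rQuanta" => 11
notation "rGrain" => 12
notation "rUnit" => 13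
notation "rSpent" => 14
notation "rEarned" => 15
notation "rThreshold" => 16
notation "rStep" => 17

/-- Increment a natural-number variable. -/
abbrev Prog.inc (a : ℕ) : Prog := .letNat a (.add (.var a) (.lit 1))

/-- The square of the weight at an address. -/
abbrev RealExpr.sqWeight (i : NatExpr) : RealExpr := .mul (.get 1 i) (.get 1 i)

namespace Projection

/-- Append the next entry of the two runs `[left, mid)` and `[right, hi)` to the buffer. -/
def mergeStep : Prog :=
  .ite (.and (.natLt (.var vLeft) (.var vMid))
      (.not (.and (.natLt (.var vRight) (.var vHi))
        (.not (.realLe (.sqWeight (.get aPerm (.var vRight)))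
          (.sqWeight (.get aPerm (.var vLeft))))))))
    (.setNat aBuffer (.var vPos) (.get aPerm (.var vLeft)) ;; .inc vLeft)
    (.setNat aBuffer (.var vPos) (.get aPerm (.var vRight)) ;; .inc vRight) ;;
  .inc vPos

/-- Set up the merging of two adjacent runs; `x - (x - y)` computes the minimum. -/
def mergeInit : Prog :=
  .letNat vMid (.sub (.var vSize) (.sub (.var vSize) (.add (.var vLo) (.var vRun)))) ;;
  .letNat vHi (.sub (.var vSize) (.sub (.var vSize)
    (.add (.var vLo) (.add (.var vRun) (.var vRun))))) ;;
  .letNat vLeft (.var vLo) ;; .letNat vRight (.var vMid) ;; .letNat vPos (.var vLo)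

/-- Merge the runs `[left, mid)` and `[right, hi)`. -/
def mergeLoop : Prog := .loop (.natLt (.var vPos) (.var vHi)) mergeStep

/-- Merge the two runs that start at `lo` into the buffer. -/
def mergeBlock : Prog := mergeInit ;; mergeLoop ;; .letNat vLo (.var vHi)

def mergeBlocks : Prog := .loop (.natLt (.var vLo) (.var vSize)) mergeBlock

def copyStep : Prog :=
  .setNat aPerm (.var vPos) (.get aBuffer (.var vPos)) ;; .inc vPos

def copyBack : Prog := .loop (.natLt (.var vPos) (.var vSize)) copyStep

/-- One pass of merge sort. -/
def mergePass : Prog :=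
  .letNat vLo (.lit 0) ;; mergeBlocks ;; .letNat vPos (.lit 0) ;; copyBack ;;
  .letNat vRun (.add (.var vRun) (.var vRun))

def sortLoop : Prog := .loop (.natLt (.var vRun) (.var vSize)) mergePass

/-- Bottom-up merge sort of the first `size` entries of the working permutation, by decreasing
square of the weights that they point to. -/
def sortLayer : Prog := .letNat vRun (.lit 1) ;; sortLoop

/-- Load one of the weight addresses of the current layer. -/
def loadStep : Prog :=
  .setNat aPerm (.var vPos) (.add (.var vOffset) (.var vPos)) ;; .inc vPos

def loadLoop : Prog := .loop (.natLt (.var vPos) (.var vSize)) loadStep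

/-- Load the addresses of all weights of the current layer. -/
def loadLayer : Prog :=
  .letNat vSize (.get 1 (.var vLayer)) ;; .letNat vPos (.lit 0) ;; loadLoop

/-- Record one entry of the sorted order. -/
def storeStep : Prog :=
  .setNat aOrder (.add (.var vOffset) (.var vPos)) (.get aPerm (.var vPos)) ;; .inc vPos

def storeLoop : Prog := .loop (.natLt (.var vPos) (.var vSize)) storeStep

/-- Record the sorted order of the current layer. -/
def storeLayer : Prog := .letNat vPos (.lit 0) ;; storeLoop

/-- Either take one more weight of the layer, or, if it does not fit into the current level of
the budget, record the number and the squared norm of the weights taken and raise the level. -/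
def scanStep : Prog :=
  .ite (.natLt (.var vPos) (.get 0 (.lit 2)))
    (.letReal rStep (.add (.get 2 (.var vLayer)) (.get 4 (.var vLayer))))
    (.letReal rStep (.add (.get 3 (.var vLayer)) (.get 4 (.var vLayer)))) ;;
  .ite (.and (.natLt (.var vPos) (.var vSize))
      (.realLe (.mul (.add (.var rSpent) (.var rStep)) (.var rQuanta)) (.var rThreshold)))
    (.letReal rSpent (.add (.var rSpent) (.var rStep)) ;;
      .letReal rEarned (.add (.var rEarned) (.sqWeight (.get aPerm (.var vPos)))) ;;
      .inc vPos)
    (.setNat aCount (.add (.var vRow) (.var vLevel)) (.var vPos) ;;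
      .setReal rGain (.var vLevel) (.var rEarned) ;;
      .inc vLevel ;;
      .letReal rThreshold (.add (.var rThreshold) (.var rCapacity)))

def scanInit : Prog :=
  .letReal rSpent (.lit 0) ;; .letReal rEarned (.lit 0) ;; .letReal rThreshold (.lit 0) ;;
  .letNat vPos (.lit 0) ;; .letNat vLevel (.lit 0)

def scanLoop : Prog := .loop (.natLe (.var vLevel) (.var vQuanta)) scanStep

/-- For every level of the budget, the largest number of weights of the layer that it can pay. -/
def scanLayer : Prog := scanInit ;; scanLoop

/-- The value of giving `share` quanta to the current layer and the rest to the earlier ones. -/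
abbrev splitValue : RealExpr :=
  .add (.get rTable (.add (.var vRow) (.sub (.var vLevel) (.var vShare))))
    (.get rGain (.var vShare))

/-- Start with the share `0`, so that the entry is the value of some split from the outset. -/
def splitInit : Prog :=
  .letNat vShare (.lit 0) ;;
  .setReal rTable (.add (.var vNext) (.var vLevel)) splitValue ;;
  .setNat aChoice (.add (.var vRow) (.var vLevel)) (.lit 0) ;;
  .letNat vShare (.lit 1)

def splitStep : Prog :=
  .ite (.realLe splitValue (.get rTable (.add (.var vNext) (.var vLevel))))
    .skip
    (.setReal rTable (.add (.var vNext) (.var vLevel)) splitValue ;;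
      .setNat aChoice (.add (.var vRow) (.var vLevel)) (.var vShare)) ;;
  .inc vShare

def splitLoop : Prog := .loop (.natLe (.var vShare) (.var vLevel)) splitStep

/-- One entry of the table of the dynamic program. -/
def tableEntry : Prog := splitInit ;; splitLoop ;; .inc vLevel

def tableLoop : Prog := .loop (.natLe (.var vLevel) (.var vQuanta)) tableEntry

/-- One row of the table of the dynamic program. -/
def tableRow : Prog :=
  .letNat vNext (.add (.var vRow) (.add (.var vQuanta) (.lit 1))) ;;
  .letNat vLevel (.lit 0) ;; tableLoop

def nextLayer : Prog :=
  .letNat vOffset (.add (.var vOffset) (.var vSize)) ;;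
  .letNat vRow (.var vNext) ;; .inc vLayer

def layerStep : Prog :=
  loadLayer ;; sortLayer ;; storeLayer ;; scanLayer ;; tableRow ;; nextLayer

def layerLoop : Prog := .loop (.natLt (.var vLayer) (.var vLayers)) layerStep

/-- Add `ε` to the unit; the number of additions until it reaches `1` is `⌈1/ε⌉`, which is counted
both as a natural number and as a real one since the machine does not convert between them. -/
def grainStep : Prog :=
  .letReal rUnit (.add (.var rUnit) (.get 0 (.lit 1))) ;; .inc vGrain ;;
  .letReal rGrain (.add (.var rGrain) (.lit 1))

def grainLoop : Prog := .loop (.not (.realLe (.lit 1) (.var rUnit))) grainStep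

def quantaStep : Prog :=
  .letNat vQuanta (.add (.var vQuanta) (.add (.var vGrain) (.lit 1))) ;;
  .letReal rQuanta (.add (.var rQuanta) (.add (.var rGrain) (.lit 1))) ;;
  .letReal rCapacity (.sub (.var rCapacity) (.get 5 (.var vLayer))) ;;
  .inc vLayer

def quantaLoop : Prog := .loop (.natLt (.var vLayer) (.var vLayers)) quantaStep

def prepareInit : Prog :=
  .letNat vLayers (.add (.get 0 (.lit 0)) (.get 0 (.lit 1))) ;;
  .letNat vQuanta (.lit 1) ;; .letReal rQuanta (.lit 1) ;;
  .letReal rCapacity (.get 0 (.lit 0))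

/-- Compute the number `1 + |U ∪ V| (⌈1/ε⌉ + 1)` of quanta and the budget left after the fixed
costs of the layers. -/
def prepare : Prog := prepareInit ;; grainLoop ;; quantaLoop ;; .letNat vLayer (.lit 0)

def outStep : Prog :=
  .setReal rOut (.get aOrder (.add (.var vOffset) (.var vPos)))
    (.get 1 (.get aOrder (.add (.var vOffset) (.var vPos)))) ;;
  .inc vPos

def outLoop : Prog := .loop (.natLt (.var vPos) (.var vHi)) outStep

def traceInit : Prog :=
  .letNat vLayer (.sub (.var vLayer) (.lit 1)) ;;
  .letNat vOffset (.sub (.var vOffset) (.get 1 (.var vLayer))) ;;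
  .letNat vRow (.sub (.var vRow) (.add (.var vQuanta) (.lit 1))) ;;
  .letNat vShare (.get aChoice (.add (.var vRow) (.var vRest))) ;;
  .letNat vRest (.sub (.var vRest) (.var vShare)) ;;
  .letNat vHi (.get aCount (.add (.var vRow) (.var vShare))) ;;
  .letNat vPos (.lit 0)

/-- Follow the choices of the dynamic program through one layer and write its output. -/
def traceStep : Prog := traceInit ;; outLoop

def traceLoop : Prog := .loop (.natLe (.lit 1) (.var vLayer)) traceStep

/-- The algorithm: processing every layer fills the tables of the dynamic program, and tracing the
choices back from the entry for all layers and all quanta gives the output. -/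
def program : Prog :=
  prepare ;; layerLoop ;; .letNat vRest (.var vQuanta) ;; traceLoop

end Projection

/-! ### Correctness of merge sort -/

/-- The list of the values of `f` on `[a, b)`. -/
def slice (f : ℕ → ℕ) (a b : ℕ) : List ℕ := (List.range' a (b - a)).map f

section Slice

variable {f g : ℕ → ℕ} {a b c : ℕ}

theorem slice_self : slice f a a = [] := by simp [slice]

theorem slice_cons (h : a < b) : slice f a b = f a :: slice f (a + 1) b := by
  obtain ⟨d, rfl⟩ := Nat.exists_eq_add_of_lt h
  simp only [slice]
  rw [show a + d + 1 - a = d + 1 by omega, show a + d + 1 - (a + 1) = d by omega,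
    List.range'_succ, List.map_cons]

theorem slice_append (h : a ≤ b) (h' : b ≤ c) : slice f a b ++ slice f b c = slice f a c := by
  simp only [slice]
  rw [← List.map_append]
  have := List.range'_append_1 (s := a) (m := b - a) (n := c - b)
  rw [show a + (b - a) = b by omega, show b - a + (c - b) = c - a by omega] at this
  rw [this]

theorem slice_snoc (h : a ≤ b) : slice f a (b + 1) = slice f a b ++ [f b] := by
  rw [← slice_append h (Nat.le_succ b), slice_cons (Nat.lt_succ_self b), slice_self]

theorem slice_congr (h : ∀ i, a ≤ i → i < b → f i = g i) : slice f a b = slice g a b := by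
  refine List.map_congr_left fun i hi => ?_
  rw [List.mem_range'_1] at hi
  exact h i hi.1 (by omega)

theorem pairwise_slice {R : ℕ → ℕ → Prop} :
    (slice f a b).Pairwise R ↔ ∀ i j, a ≤ i → i < j → j < b → R (f i) (f j) := by
  rw [slice, List.pairwise_map]
  constructor
  · intro h i j hi hij hj
    rw [List.pairwise_iff_getElem] at h
    have := h (i - a) (j - a) (by simp; omega) (by simp; omega) (by omega)
    simpa [Nat.add_sub_cancel' hi, Nat.add_sub_cancel' (hi.trans hij.le)] using this
  · intro h
    rw [List.pairwise_iff_getElem]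
    intro i j hi hj hij
    simp only [List.length_range'] at hi hj
    simpa using h (a + i) (a + j) (by omega) (by omega) (by omega)

end Slice

namespace Projection

/-- The square of the weight stored at an address. -/
def weightSq (Z : ℕ → ℝ) (x : ℕ) : ℝ := Z x * Z x

open Classical in
/-- The order in which merge sort arranges addresses: by decreasing square of the weight. -/
noncomputable def sqGe (Z : ℕ → ℝ) (x y : ℕ) : Bool := decide (weightSq Z y ≤ weightSq Z x)

/-- The loop invariant: the buffer holds the merged part, and what is left to merge is the rest
of the two runs. -/
def MergeInv (σ : Memory) (lo mid hi t : ℕ) (τ : Memory) : Prop :=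
  τ.nat vPos 0 = lo + t ∧ (∀ x < lo, τ.nat aBuffer x = σ.nat aBuffer x) ∧
  ∃ i j, τ.nat vLeft 0 = i ∧ τ.nat vRight 0 = j ∧ lo ≤ i ∧ i ≤ mid ∧ mid ≤ j ∧ j ≤ hi ∧
    i + j = mid + (lo + t) ∧
    slice (τ.nat aBuffer) lo (lo + t) ++
      List.merge (slice (σ.nat aPerm) i mid) (slice (σ.nat aPerm) j hi) (sqGe (σ.real 1)) =
    List.merge (slice (σ.nat aPerm) lo mid) (slice (σ.nat aPerm) mid hi) (sqGe (σ.real 1))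

theorem mergeStep_spec {σ τ : Memory} {lo mid hi t : ℕ} (hmid : τ.nat vMid 0 = mid)
    (hhi : τ.nat vHi 0 = hi) (hperm : τ.nat aPerm = σ.nat aPerm) (hZ : τ.real 1 = σ.real 1)
    (ht : lo + t < hi) (h : MergeInv σ lo mid hi t τ) :
    Exec mergeStep τ 100 (MergeInv σ lo mid hi (t + 1)) := by
  obtain ⟨hpos, hbuf, i, j, hi', hj', h1, h2, h3, h4, h5, h6⟩ := h
  refine .loopFree _ rfl (by decide) ?_
  by_cases hc : i < mid ∧ (j < hi → weightSq (σ.real 1) (σ.nat aPerm j) ≤ weightSq (σ.real 1) (σ.nat aPerm i))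
  · have hm : List.merge (slice (σ.nat aPerm) i mid) (slice (σ.nat aPerm) j hi) (sqGe (σ.real 1))
        = σ.nat aPerm i :: List.merge (slice (σ.nat aPerm) (i + 1) mid) (slice (σ.nat aPerm) j hi)
          (sqGe (σ.real 1)) := by
      rw [slice_cons hc.1]
      rcases Nat.lt_or_ge j hi with hj | hj
      · rw [slice_cons hj, List.cons_merge_cons_pos]
        simpa [sqGe] using hc.2 hj
      · rw [show j = hi by omega, slice_self, List.merge_right, List.merge_right]
    have hb : (Test.and (.natLt (.var vLeft) (.var vMid))
      (.not (.and (.natLt (.var vRight) (.var vHi))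
        (.not (.realLe (.sqWeight (.get aPerm (.var vRight)))
          (.sqWeight (.get aPerm (.var vLeft)))))))).Holds τ := by
      simp only [Test.Holds, NatExpr.eval, RealExpr.eval, hi', hj', hmid, hhi, hperm, hZ]
      refine ⟨by omega, fun h => h.2 (hc.2 (by omega))⟩
    rw [mergeStep, Prog.eval_seq, Prog.eval_ite_pos hb]
    refine ⟨?_, ?_, i + 1, j, ?_, ?_, by omega, by omega, by omega, by omega, by omega, ?_⟩
    · simp [Prog.eval, NatExpr.eval, hpos]; omega
    · intro x hx
      simp [Prog.eval, NatExpr.eval, hpos, hbuf x hx]; omega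
    · simp [Prog.eval, NatExpr.eval, hi']
    · simp [Prog.eval, NatExpr.eval, hj']
    · rw [← h6, hm, ← Nat.add_assoc, slice_snoc (by omega), List.append_assoc]
      congr 1
      · refine slice_congr fun x _ hx => ?_
        simp [Prog.eval, NatExpr.eval, hpos]; omega
      · simp [Prog.eval, NatExpr.eval, hpos, hperm, hi']
  · -- If the second run were used up, the first would not be, since `lo + t < hi`.
    have hj : j < hi := by
      by_contra hj
      exact hc ⟨by omega, fun h => absurd h hj⟩
    have hm : List.merge (slice (σ.nat aPerm) i mid) (slice (σ.nat aPerm) j hi) (sqGe (σ.real 1))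
        = σ.nat aPerm j :: List.merge (slice (σ.nat aPerm) i mid) (slice (σ.nat aPerm) (j + 1) hi)
          (sqGe (σ.real 1)) := by
      rw [slice_cons hj]
      rcases Nat.lt_or_ge i mid with hi | hi
      · rw [slice_cons hi, List.cons_merge_cons_neg]
        simpa [sqGe, hi, hj] using hc
      · rw [show i = mid by omega, slice_self, List.nil_merge, List.nil_merge]
    have hb : ¬ (Test.and (.natLt (.var vLeft) (.var vMid))
      (.not (.and (.natLt (.var vRight) (.var vHi))
        (.not (.realLe (.sqWeight (.get aPerm (.var vRight)))
          (.sqWeight (.get aPerm (.var vLeft)))))))).Holds τ := by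
      simp only [Test.Holds, NatExpr.eval, RealExpr.eval, hi', hj', hmid, hhi, hperm, hZ]
      exact fun h => hc ⟨by omega, fun _ => by_contra fun h' => h.2 ⟨by omega, h'⟩⟩
    rw [mergeStep, Prog.eval_seq, Prog.eval_ite_neg hb]
    refine ⟨?_, ?_, i, j + 1, ?_, ?_, by omega, by omega, by omega, by omega, by omega, ?_⟩
    · simp [Prog.eval, NatExpr.eval, hpos]; omega
    · intro x hx
      simp [Prog.eval, NatExpr.eval, hpos, hbuf x hx]; omega
    · simp [Prog.eval, NatExpr.eval, hi']
    · simp [Prog.eval, NatExpr.eval, hj']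
    · rw [← h6, hm, ← Nat.add_assoc, slice_snoc (by omega), List.append_assoc]
      congr 1
      · refine slice_congr fun x _ hx => ?_
        simp [Prog.eval, NatExpr.eval, hpos]; omega
      · simp [Prog.eval, NatExpr.eval, hpos, hperm, hj']

theorem mergeBlock_spec {σ : Memory} {m w lo mid hi : ℕ} (hm : σ.nat vSize 0 = m)
    (hw : σ.nat vRun 0 = w) (hlo : σ.nat vLo 0 = lo) (hlt : lo < m)
    (hmid : mid = min (lo + w) m) (hhi : hi = min (lo + (w + w)) m) :
    Exec mergeBlock σ (200 + 110 * (hi - lo)) fun τ =>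
      τ.nat vLo 0 = hi ∧ (∀ x < lo, τ.nat aBuffer x = σ.nat aBuffer x) ∧
      slice (τ.nat aBuffer) lo hi =
        List.merge (slice (σ.nat aPerm) lo mid) (slice (σ.nat aPerm) mid hi)
          (sqGe (σ.real 1)) := by
  refine .seq (Mid := fun τ => τ.nat vMid 0 = mid ∧ τ.nat vHi 0 = hi ∧ MergeInv σ lo mid hi 0 τ)
    100 (100 + 110 * (hi - lo)) ?_ ?_ (by omega)
  · refine .loopFree _ rfl (by decide) ?_
    refine ⟨?_, ?_, ?_, ?_, lo, mid, ?_, ?_, le_rfl, by omega, le_rfl, by omega, by omega, ?_⟩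
    · simp [mergeInit, Prog.eval, NatExpr.eval, hm, hlo, hw]; omega
    · simp [mergeInit, Prog.eval, NatExpr.eval, hm, hlo, hw]; omega
    · simp [mergeInit, Prog.eval, NatExpr.eval, hlo]
    · intro x hx
      simp [mergeInit, Prog.eval, NatExpr.eval]
    · simp [mergeInit, Prog.eval, NatExpr.eval, hlo]
    · simp [mergeInit, Prog.eval, NatExpr.eval, hm, hlo, hw]; omega
    · rw [Nat.add_zero, slice_self, List.nil_append]
  · rintro τ hF ⟨h1, h2, h3⟩
    refine .seq (50 + 110 * (hi - lo)) 50 (Exec.loop_const (hi - lo) 100 (MergeInv σ lo mid hi) h3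
      (fun t ρ ht hG hI => ⟨?_, ?_⟩) ?_ ?_) ?_ (by omega)
    · have : ρ.nat vHi 0 = hi := by rw [hG.1 _ (by decide), h2]
      simp only [Test.Holds, NatExpr.eval, this, hI.1]; omega
    · refine mergeStep_spec ?_ ?_ ?_ ?_ (by omega) hI
      · rw [hG.1 _ (by decide), h1]
      · rw [hG.1 _ (by decide), h2]
      · rw [hG.1 _ (by decide), hF.1 _ (by decide)]
      · rw [hG.2 _ (by decide), hF.2 _ (by decide)]
    · intro ρ hG hI
      have : ρ.nat vHi 0 = hi := by rw [hG.1 _ (by decide), h2]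
      simp only [Test.Holds, NatExpr.eval, this, hI.1]; omega
    · simp only [Test.cost, NatExpr.cost]; omega
    · rintro ρ hG ⟨hpos, hbuf, i, j, hi', hj', g1, g2, g3, g4, g5, g6⟩
      refine .loopFree _ rfl (by decide) ?_
      have : ρ.nat vHi 0 = hi := by rw [hG.1 _ (by decide), h2]
      refine ⟨by simp [Prog.eval, NatExpr.eval, this], fun x hx => ?_, ?_⟩
      · simp [Prog.eval, NatExpr.eval, hbuf x hx]
      · rw [show i = mid by omega, show j = hi by omega, slice_self, slice_self,
          List.merge_right, List.append_nil, show lo + (hi - lo) = hi by omega] at g6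
        simpa [Prog.eval, NatExpr.eval] using g6

theorem sqGe_trans {Z : ℕ → ℝ} (x y z : ℕ) (h : sqGe Z x y = true) (h' : sqGe Z y z = true) :
    sqGe Z x z = true := by
  simp only [sqGe, decide_eq_true_eq] at *
  exact h'.trans h

theorem sqGe_total {Z : ℕ → ℝ} (x y : ℕ) : (sqGe Z x y || sqGe Z y x) = true := by
  simp only [sqGe, Bool.or_eq_true, decide_eq_true_eq]
  exact le_total _ _

/-- The blocks of length `w` into which `[0, m)` is cut are sorted. -/
def RunsSorted (Z : ℕ → ℝ) (f : ℕ → ℕ) (w m : ℕ) : Prop :=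
  ∀ i j, i < j → j < m → i / w = j / w → weightSq Z (f j) ≤ weightSq Z (f i)

theorem RunsSorted.pairwise {Z : ℕ → ℝ} {f : ℕ → ℕ} {w m a b d : ℕ} (h : RunsSorted Z f w m)
    (hd : w ∣ d) (hda : d ≤ a) (hbd : b ≤ d + w) (hb : b ≤ m) :
    (slice f a b).Pairwise (fun x y => sqGe Z x y = true) := by
  rw [pairwise_slice]
  intro i j hi hij hj
  simp only [sqGe, decide_eq_true_eq]
  refine h i j hij (by omega) ?_
  obtain ⟨c, rfl⟩ := hd
  have hw : 0 < w := by omega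
  rw [Nat.div_eq_of_lt_le (k := c) (by rw [Nat.mul_comm]; omega)
      (by rw [Nat.add_mul, Nat.mul_comm]; omega),
    Nat.div_eq_of_lt_le (k := c) (by rw [Nat.mul_comm]; omega)
      (by rw [Nat.add_mul, Nat.mul_comm]; omega)]

theorem mergeBlocks_spec {σ : Memory} {m w : ℕ} (hm : σ.nat vSize 0 = m)
    (hw : σ.nat vRun 0 = w) (hw0 : 0 < w) (hlo : σ.nat vLo 0 = 0)
    (hs : RunsSorted (σ.real 1) (σ.nat aPerm) w m) :
    Exec mergeBlocks σ (400 * m + 20) fun τ =>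
      (slice (τ.nat aBuffer) 0 m).Perm (slice (σ.nat aPerm) 0 m) ∧
      RunsSorted (σ.real 1) (τ.nat aBuffer) (w + w) m := by
  refine (Exec.loop_potential (fun τ => 400 * (m - τ.nat vLo 0)) (fun τ => τ.nat vLo 0 ≤ m ∧
    (τ.nat vLo 0 = m ∨ (w + w) ∣ τ.nat vLo 0) ∧
    (slice (τ.nat aBuffer) 0 (τ.nat vLo 0)).Perm (slice (σ.nat aPerm) 0 (τ.nat vLo 0)) ∧
    RunsSorted (σ.real 1) (τ.nat aBuffer) (w + w) (τ.nat vLo 0)) ?_ ?_ le_rfl).mono ?_ ?_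
  · rw [hlo]
    refine ⟨by omega, .inr (dvd_zero _), by rw [slice_self, slice_self], fun i j _ h => ?_⟩
    omega
  · rintro τ hF ⟨h1, h2, h3, h4⟩ hb
    have hm' : τ.nat vSize 0 = m := by rw [hF.1 _ (by decide), hm]
    have hw' : τ.nat vRun 0 = w := by rw [hF.1 _ (by decide), hw]
    have hp' : τ.nat aPerm = σ.nat aPerm := hF.1 _ (by decide)
    have hZ' : τ.real 1 = σ.real 1 := hF.2 _ (by decide)
    generalize hl : τ.nat vLo 0 = lo at *
    have hlt : lo < m := by
      simpa only [Test.Holds, NatExpr.eval, hl, hm', not_le] using hb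
    have hdvd : (w + w) ∣ lo := by
      rcases h2 with h2 | h2
      · omega
      · exact h2
    have hdvd' : w ∣ lo := (Dvd.intro 2 (by omega)).trans hdvd
    obtain ⟨mid, hmid⟩ : ∃ x, x = min (lo + w) m := ⟨_, rfl⟩
    obtain ⟨hi, hhi⟩ : ∃ x, x = min (lo + (w + w)) m := ⟨_, rfl⟩
    refine ⟨_, (mergeBlock_spec hm' hw' hl hlt hmid hhi).mono le_rfl ?_⟩
    rintro ρ - ⟨g1, g2, g3⟩
    rw [hp', hZ'] at g3
    have hold : slice (ρ.nat aBuffer) 0 lo = slice (τ.nat aBuffer) 0 lo :=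
      slice_congr fun x _ hx => g2 x hx
    have hperm : (slice (ρ.nat aBuffer) lo hi).Perm (slice (σ.nat aPerm) lo hi) := by
      rw [g3, ← slice_append (show lo ≤ mid by omega) (show mid ≤ hi by omega)]
      exact List.merge_perm_append ..
    have hsort : (slice (ρ.nat aBuffer) lo hi).Pairwise
        (fun x y => sqGe (σ.real 1) x y = true) := by
      rw [g3]
      refine List.pairwise_merge sqGe_trans sqGe_total _ _ ?_ ?_
      · exact hs.pairwise hdvd' le_rfl (by omega) (by omega)
      · rcases Nat.lt_or_ge mid hi with h | h
        · exact hs.pairwise (hdvd'.add (dvd_refl w)) (by omega) (by omega) (by omega)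
        · rw [show hi = mid by omega, slice_self]
          exact .nil
    rw [g1]
    refine ⟨⟨by omega, ?_, ?_, ?_⟩, ?_⟩
    · rcases Nat.lt_or_ge m (lo + (w + w)) with h | h
      · exact .inl (by omega)
      · exact .inr (by rw [show hi = lo + (w + w) by omega]; exact hdvd.add (dvd_refl _))
    · rw [← slice_append (show 0 ≤ lo by omega) (show lo ≤ hi by omega), hold,
        ← slice_append (f := σ.nat aPerm) (show 0 ≤ lo by omega) (show lo ≤ hi by omega)]
      exact h3.append hperm
    · intro i j hij hj hd
      rcases Nat.lt_or_ge j lo with hjl | hjl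
      · rw [g2 j hjl, g2 i (by omega)]
        exact h4 i j hij hjl hd
      · rcases Nat.lt_or_ge i lo with hil | hil
        · -- As `lo` is a multiple of `w + w`, no block reaches across it.
          exfalso
          obtain ⟨c, hc⟩ := hdvd
          have h5 : i / (w + w) < c := by
            rw [Nat.div_lt_iff_lt_mul (by omega), Nat.mul_comm]; omega
          have h6 : c ≤ j / (w + w) := by
            rw [Nat.le_div_iff_mul_le (by omega), Nat.mul_comm]; omega
          omega
        · have := pairwise_slice.1 hsort i j hil hij hj
          simpa only [sqGe, decide_eq_true_eq] using this
    · simp only [Test.cost, NatExpr.cost]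
      omega
  · simp only [Test.cost, NatExpr.cost]
    omega
  · rintro τ hF ⟨⟨h1, h2, h3, h4⟩, hb⟩
    have hm' : τ.nat vSize 0 = m := by rw [hF.1 _ (by decide), hm]
    have hl : τ.nat vLo 0 = m := by
      simp only [Test.Holds, NatExpr.eval, hm'] at hb
      omega
    rw [hl] at h3 h4
    exact ⟨h3, h4⟩

theorem copyBack_spec {σ : Memory} {m : ℕ} (hm : σ.nat vSize 0 = m) (hpos : σ.nat vPos 0 = 0) :
    Exec copyBack σ (50 * m + 20) fun τ => ∀ x < m, τ.nat aPerm x = σ.nat aBuffer x := by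
  refine (Exec.loop_const m 30 (fun t τ => τ.nat vPos 0 = t ∧
    ∀ x < t, τ.nat aPerm x = σ.nat aBuffer x) ⟨hpos, fun x h => absurd h (by omega)⟩
    ?_ ?_ le_rfl).mono ?_ ?_
  · rintro t τ ht hF ⟨h1, h2⟩
    have hm' : τ.nat vSize 0 = m := by rw [hF.1 _ (by decide), hm]
    have hb' : τ.nat aBuffer = σ.nat aBuffer := hF.1 _ (by decide)
    refine ⟨by simp only [Test.Holds, NatExpr.eval, hm', h1]; omega, ?_⟩
    refine .loopFree _ rfl (by decide) ⟨by simp [copyStep, Prog.eval, NatExpr.eval, h1], ?_⟩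
    intro x hx
    rcases Nat.lt_or_ge x t with h | h
    · simp [copyStep, Prog.eval, NatExpr.eval, h1, h2 x h]; omega
    · obtain rfl : x = t := by omega
      simp [copyStep, Prog.eval, NatExpr.eval, h1, hb']
  · rintro τ hF ⟨h1, -⟩
    have hm' : τ.nat vSize 0 = m := by rw [hF.1 _ (by decide), hm]
    simp only [Test.Holds, NatExpr.eval, hm', h1]
    omega
  · simp only [Test.cost, NatExpr.cost]
    omega
  · exact fun τ _ h => h.2

theorem mergePass_spec {σ : Memory} {m w : ℕ} (hm : σ.nat vSize 0 = m)
    (hw : σ.nat vRun 0 = w) (hw0 : 0 < w)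
    (hs : RunsSorted (σ.real 1) (σ.nat aPerm) w m) :
    Exec mergePass σ (500 * m + 200) fun τ => τ.nat vRun 0 = w + w ∧
      (slice (τ.nat aPerm) 0 m).Perm (slice (σ.nat aPerm) 0 m) ∧
      RunsSorted (σ.real 1) (τ.nat aPerm) (w + w) m := by
  refine .seq (Mid := fun τ => τ.nat vLo 0 = 0 ∧ RunsSorted (σ.real 1) (τ.nat aPerm) w m ∧
    τ.nat aPerm = σ.nat aPerm) 20 (500 * m + 180)
    (.loopFree _ rfl (by decide) ?_) ?_ (by omega)
  · refine ⟨by simp [Prog.eval, NatExpr.eval], by simpa [Prog.eval, NatExpr.eval] using hs,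
      by simp [Prog.eval, NatExpr.eval]⟩
  rintro τ₁ hF₁ ⟨hlo, hs₁, hp₁⟩
  have hm₁ : τ₁.nat vSize 0 = m := by rw [hF₁.1 _ (by decide), hm]
  have hw₁ : τ₁.nat vRun 0 = w := by rw [hF₁.1 _ (by decide), hw]
  have hZ₁ : τ₁.real 1 = σ.real 1 := hF₁.2 _ (by decide)
  refine .seq _ (50 * m + 100) (mergeBlocks_spec hm₁ hw₁ hw0 hlo (by rwa [hZ₁])) ?_ (by omega)
  rintro τ₂ hF₂ ⟨hperm, hsort⟩
  have hm₂ : τ₂.nat vSize 0 = m := by rw [hF₂.1 _ (by decide), hm₁]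
  have hw₂ : τ₂.nat vRun 0 = w := by rw [hF₂.1 _ (by decide), hw₁]
  refine .seq (Mid := fun τ => τ.nat vPos 0 = 0 ∧ τ.nat aBuffer = τ₂.nat aBuffer)
    20 (50 * m + 80) (.loopFree _ rfl (by decide) ?_) ?_ (by omega)
  · exact ⟨by simp [Prog.eval, NatExpr.eval], by simp [Prog.eval, NatExpr.eval]⟩
  rintro τ₃ hF₃ ⟨hpos, hb₃⟩
  have hm₃ : τ₃.nat vSize 0 = m := by rw [hF₃.1 _ (by decide), hm₂]
  have hw₃ : τ₃.nat vRun 0 = w := by rw [hF₃.1 _ (by decide), hw₂]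
  refine .seq _ 60 (copyBack_spec hm₃ hpos) ?_ (by omega)
  intro τ₄ hF₄ hc
  have hw₄ : τ₄.nat vRun 0 = w := by rw [hF₄.1 _ (by decide), hw₃]
  rw [hb₃] at hc
  refine .loopFree _ rfl (by decide) ⟨by simp [Prog.eval, NatExpr.eval, hw₄], ?_, ?_⟩
  · rw [slice_congr (g := τ₂.nat aBuffer) fun x _ hx => by simpa [Prog.eval] using hc x hx]
    rw [hp₁] at hperm
    exact hperm
  · intro i j hij hj hd
    rw [hZ₁] at hsort
    simpa [Prog.eval, hc i (by omega), hc j hj] using hsort i j hij hj hd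

theorem sortLayer_spec {σ : Memory} {m : ℕ} (hm : σ.nat vSize 0 = m) :
    Exec sortLayer σ (Nat.clog 2 m * (500 * m + 250) + 50) fun τ =>
      (slice (τ.nat aPerm) 0 m).Perm (slice (σ.nat aPerm) 0 m) ∧
      ∀ i j, i < j → j < m → weightSq (σ.real 1) (τ.nat aPerm j) ≤ weightSq (σ.real 1) (τ.nat aPerm i) := by
  refine .seq (Mid := fun τ => τ.nat vRun 0 = 1 ∧ τ.nat aPerm = σ.nat aPerm) 20
    (Nat.clog 2 m * (500 * m + 250) + 30) (.loopFree _ rfl (by decide) ?_) ?_ (by omega)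
  · exact ⟨by simp [Prog.eval, NatExpr.eval], by simp [Prog.eval, NatExpr.eval]⟩
  rintro τ hF ⟨hw, hp⟩
  have hm' : τ.nat vSize 0 = m := by rw [hF.1 _ (by decide), hm]
  have hZ : τ.real 1 = σ.real 1 := hF.2 _ (by decide)
  refine (Exec.loop_const (Nat.clog 2 m) (500 * m + 200) (fun t ρ => ρ.nat vRun 0 = 2 ^ t ∧
      (slice (ρ.nat aPerm) 0 m).Perm (slice (σ.nat aPerm) 0 m) ∧
      RunsSorted (σ.real 1) (ρ.nat aPerm) (2 ^ t) m) ?_ ?_ ?_ le_rfl).mono ?_ ?_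
  · refine ⟨by simpa using hw, by rw [hp], fun i j hij _ hd => ?_⟩
    simp only [pow_zero, Nat.div_one] at hd
    omega
  · rintro t ρ ht hG ⟨h1, h2, h3⟩
    have hm'' : ρ.nat vSize 0 = m := by rw [hG.1 _ (by decide), hm']
    have hZ' : ρ.real 1 = σ.real 1 := by rw [hG.2 _ (by decide), hZ]
    refine ⟨?_, (mergePass_spec hm'' h1 (by positivity) (by rwa [hZ'])).mono le_rfl ?_⟩
    · simp only [Test.Holds, NatExpr.eval, hm'', h1, not_le]
      exact (Nat.lt_clog_iff_pow_lt (by norm_num)).1 ht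
    · rintro ρ' - ⟨g1, g2, g3⟩
      rw [← two_mul, ← pow_succ'] at g1 g3
      rw [hZ'] at g3
      exact ⟨g1, g2.trans h2, g3⟩
  · rintro ρ hG ⟨h1, -⟩
    have hm'' : ρ.nat vSize 0 = m := by rw [hG.1 _ (by decide), hm']
    simp only [Test.Holds, NatExpr.eval, hm'', h1, not_not]
    exact Nat.le_pow_clog (by norm_num) m
  · simp only [Test.cost, NatExpr.cost]
    have : Nat.clog 2 m * (500 * m + 200 + (1 + 1 + (1 + 1) + 1 + 1) + 1)
        ≤ Nat.clog 2 m * (500 * m + 250) := Nat.mul_le_mul_left _ (by omega)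
    omega
  · rintro ρ - ⟨-, h2, h3⟩
    refine ⟨h2, fun i j hij hj => h3 i j hij hj ?_⟩
    have := Nat.le_pow_clog (b := 2) (by norm_num) m
    rw [Nat.div_eq_of_lt (by omega), Nat.div_eq_of_lt (by omega)]

/-! ### Loading, storing and scanning one layer -/

theorem loadLayer_spec {σ : Memory} {u m o : ℕ} (hu : σ.nat vLayer 0 = u)
    (ho : σ.nat vOffset 0 = o) (hm : σ.nat 1 u = m) :
    Exec loadLayer σ (100 * m + 100) fun τ =>
      τ.nat vSize 0 = m ∧ ∀ x < m, τ.nat aPerm x = o + x := by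
  refine .seq (Mid := fun τ => τ.nat vSize 0 = m) 20 (100 * m + 80)
    (.loopFree _ rfl (by decide) (by simp [Prog.eval, NatExpr.eval, hu, hm])) ?_ (by omega)
  intro τ₁ hF₁ hm₁
  refine .seq (Mid := fun τ => τ.nat vPos 0 = 0) 20 (100 * m + 60)
    (.loopFree _ rfl (by decide) (by simp [Prog.eval, NatExpr.eval])) ?_ (by omega)
  intro τ₂ hF₂ hpos
  have hm₂ : τ₂.nat vSize 0 = m := by rw [hF₂.1 _ (by decide), hm₁]
  have ho₂ : τ₂.nat vOffset 0 = o := by rw [hF₂.1 _ (by decide), hF₁.1 _ (by decide), ho]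
  refine (Exec.loop_const m 50 (fun t τ => τ.nat vPos 0 = t ∧ ∀ x < t, τ.nat aPerm x = o + x)
    ⟨hpos, fun x h => absurd h (by omega)⟩ ?_ ?_ le_rfl).mono ?_ ?_
  · rintro t τ ht hF ⟨h1, h2⟩
    have hm' : τ.nat vSize 0 = m := by rw [hF.1 _ (by decide), hm₂]
    have ho' : τ.nat vOffset 0 = o := by rw [hF.1 _ (by decide), ho₂]
    refine ⟨by simp only [Test.Holds, NatExpr.eval, hm', h1]; omega, ?_⟩
    refine .loopFree _ rfl (by decide) ⟨by simp [loadStep, Prog.eval, NatExpr.eval, h1], ?_⟩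
    intro x hx
    rcases Nat.lt_or_ge x t with h | h
    · simp [loadStep, Prog.eval, NatExpr.eval, h1, h2 x h]; omega
    · obtain rfl : x = t := by omega
      simp [loadStep, Prog.eval, NatExpr.eval, h1, ho']
  · rintro τ hF ⟨h1, -⟩
    have hm' : τ.nat vSize 0 = m := by rw [hF.1 _ (by decide), hm₂]
    simp only [Test.Holds, NatExpr.eval, hm', h1]
    omega
  · simp only [Test.cost, NatExpr.cost]
    omega
  · rintro τ hF ⟨-, h⟩
    exact ⟨by rw [hF.1 _ (by decide), hm₂], h⟩

theorem storeLayer_spec {σ : Memory} {m o : ℕ} (ho : σ.nat vOffset 0 = o)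
    (hm : σ.nat vSize 0 = m) :
    Exec storeLayer σ (100 * m + 100) fun τ =>
      (∀ x < m, τ.nat aOrder (o + x) = σ.nat aPerm x) ∧
      ∀ x < o, τ.nat aOrder x = σ.nat aOrder x := by
  refine .seq (Mid := fun τ => τ.nat vPos 0 = 0 ∧ τ.nat aOrder = σ.nat aOrder) 20 (100 * m + 80)
    (.loopFree _ rfl (by decide)
      ⟨by simp [Prog.eval, NatExpr.eval], by simp [Prog.eval, NatExpr.eval]⟩) ?_ (by omega)
  rintro τ₁ hF₁ ⟨hpos, ho₁⟩
  have hm₁ : τ₁.nat vSize 0 = m := by rw [hF₁.1 _ (by decide), hm]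
  have ho₂ : τ₁.nat vOffset 0 = o := by rw [hF₁.1 _ (by decide), ho]
  have hp₁ : τ₁.nat aPerm = σ.nat aPerm := hF₁.1 _ (by decide)
  refine (Exec.loop_const m 50 (fun t τ => τ.nat vPos 0 = t ∧
    (∀ x < t, τ.nat aOrder (o + x) = σ.nat aPerm x) ∧ ∀ x < o, τ.nat aOrder x = σ.nat aOrder x)
    ⟨hpos, fun x h => absurd h (by omega), fun x _ => by rw [ho₁]⟩ ?_ ?_ le_rfl).mono ?_ ?_
  · rintro t τ ht hF ⟨h1, h2, h3⟩
    have hm' : τ.nat vSize 0 = m := by rw [hF.1 _ (by decide), hm₁]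
    have ho' : τ.nat vOffset 0 = o := by rw [hF.1 _ (by decide), ho₂]
    have hp' : τ.nat aPerm = σ.nat aPerm := by rw [hF.1 _ (by decide), hp₁]
    refine ⟨by simp only [Test.Holds, NatExpr.eval, hm', h1]; omega, ?_⟩
    refine .loopFree _ rfl (by decide) ⟨by simp [storeStep, Prog.eval, NatExpr.eval, h1], ?_, ?_⟩
    · intro x hx
      rcases Nat.lt_or_ge x t with h | h
      · simp [storeStep, Prog.eval, NatExpr.eval, h1, ho', h2 x h]; omega
      · obtain rfl : x = t := by omega
        simp [storeStep, Prog.eval, NatExpr.eval, h1, ho', hp']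
    · intro x hx
      simp [storeStep, Prog.eval, NatExpr.eval, h1, ho', h3 x hx]; omega
  · rintro τ hF ⟨h1, -⟩
    have hm' : τ.nat vSize 0 = m := by rw [hF.1 _ (by decide), hm₁]
    simp only [Test.Holds, NatExpr.eval, hm', h1]
    omega
  · simp only [Test.cost, NatExpr.cost]
    omega
  · rintro τ hF ⟨-, h⟩
    exact h

/-- The energy of the weight number `i` (counted from `0`, in the order in which weights are
taken) of layer `u`, as given by the input memory `σ`. -/
noncomputable def stepCost (σ : Memory) (u i : ℕ) : ℝ :=
  (if i < σ.nat 0 2 then σ.real 2 u else σ.real 3 u) + σ.real 4 u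

/-- The energy, apart from the fixed one, of layer `u` if it has `c` nonzero weights. -/
noncomputable def layerCost (σ : Memory) (u c : ℕ) : ℝ := ∑ i ∈ Finset.range c, stepCost σ u i

theorem layerCost_mono {σ : Memory} {u c d : ℕ} (h : ∀ i, 0 ≤ stepCost σ u i) (hcd : c ≤ d) :
    layerCost σ u c ≤ layerCost σ u d :=
  Finset.sum_le_sum_of_subset_of_nonneg (Finset.range_mono hcd) fun i _ _ => h i

/-- The count `c` is the largest one, up to `m`, that a share of `q` out of `Q` quanta of the
capacity `B` can pay. -/
def MaxCount (σ : Memory) (Q : ℕ) (B : ℝ) (u m q c : ℕ) : Prop :=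
  c ≤ m ∧ layerCost σ u c * Q ≤ q * B ∧ ∀ d ≤ m, layerCost σ u d * Q ≤ q * B → d ≤ c

/-- The squared norm of the first `c` weights in the order `f`. -/
noncomputable def gain (Z : ℕ → ℝ) (f : ℕ → ℕ) (c : ℕ) : ℝ := ∑ i ∈ Finset.range c, weightSq Z (f i)

/-- The invariant of the scan: `pos` weights are taken so far, they fit into the current level of the
budget, and all smaller levels are settled. -/
structure ScanInv (σ : Memory) (u m Q row : ℕ) (B : ℝ) (τ : Memory) : Prop where
  pos_le : τ.nat vPos 0 ≤ m
  level_le : τ.nat vLevel 0 ≤ Q + 1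
  spent : τ.real rSpent 0 = layerCost σ u (τ.nat vPos 0)
  earned : τ.real rEarned 0 = gain (σ.real 1) (σ.nat aPerm) (τ.nat vPos 0)
  threshold : τ.real rThreshold 0 = τ.nat vLevel 0 * B
  fits : layerCost σ u (τ.nat vPos 0) * Q ≤ τ.nat vLevel 0 * B
  old : ∀ x < row, τ.nat aCount x = σ.nat aCount x
  done : ∀ q < τ.nat vLevel 0, MaxCount σ Q B u m q (τ.nat aCount (row + q)) ∧
    τ.real rGain q = gain (σ.real 1) (σ.nat aPerm) (τ.nat aCount (row + q))

theorem scanStep_spec {σ τ : Memory} {u m Q row : ℕ} {B : ℝ} (hu : τ.nat vLayer 0 = u)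
    (hm : τ.nat vSize 0 = m) (hrow : τ.nat vRow 0 = row) (hrQ : τ.real rQuanta 0 = Q)
    (hB : τ.real rCapacity 0 = B) (hB0 : 0 ≤ B) (hc : ∀ i, 0 ≤ stepCost σ u i)
    (h0 : τ.nat 0 = σ.nat 0) (hZ : τ.real 1 = σ.real 1) (h2 : τ.real 2 = σ.real 2)
    (h3 : τ.real 3 = σ.real 3) (h4 : τ.real 4 = σ.real 4) (hp : τ.nat aPerm = σ.nat aPerm)
    (hl : τ.nat vLevel 0 ≤ Q) (h : ScanInv σ u m Q row B τ) :
    Exec scanStep τ 200 fun ρ => ScanInv σ u m Q row B ρ ∧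
      (m - ρ.nat vPos 0) + (Q + 1 - ρ.nat vLevel 0) < (m - τ.nat vPos 0) + (Q + 1 - τ.nat vLevel 0)
      := by
  obtain ⟨g1, g2, g3, g4, g5, g6, g7, g8⟩ := h
  generalize hi : τ.nat vPos 0 = i at *
  generalize hl' : τ.nat vLevel 0 = l at *
  refine .seq (Mid := fun ρ => ρ = τ.writeReal rStep 0 (stepCost σ u i)) 60 140
    (.loopFree _ rfl (by decide) ?_) ?_ (by omega)
  · by_cases hk : i < σ.nat 0 2
    · rw [Prog.eval_ite_pos (by
        simp only [Test.Holds, NatExpr.eval, h0, hi]; omega)]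
      simp [Prog.eval, NatExpr.eval, RealExpr.eval, hu, h2, h4, stepCost, hk]
    · rw [Prog.eval_ite_neg (by
        simp only [Test.Holds, NatExpr.eval, h0, hi]; omega)]
      simp [Prog.eval, NatExpr.eval, RealExpr.eval, hu, h3, h4, stepCost, hk]
  rintro ρ - rfl
  refine .loopFree _ rfl (by decide) ?_
  by_cases hb : i < m ∧ layerCost σ u (i + 1) * Q ≤ l * B
  · rw [Prog.eval_ite_pos (by
      simpa [Test.Holds, NatExpr.eval, RealExpr.eval, hi, hm, g3, hrQ, g5, layerCost,
        Finset.sum_range_succ] using hb)]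
    refine ⟨⟨?_, ?_, ?_, ?_, ?_, ?_, ?_, ?_⟩, ?_⟩
    · simp [Prog.eval, NatExpr.eval, hi]; omega
    · simp [Prog.eval, hl']; omega
    · simp [Prog.eval, NatExpr.eval, RealExpr.eval, hi, g3, layerCost, Finset.sum_range_succ]
    · simp [Prog.eval, NatExpr.eval, RealExpr.eval, hi, g4, gain, Finset.sum_range_succ, hp, hZ,
        weightSq]
    · simp [Prog.eval, hl', g5]
    · simpa [Prog.eval, NatExpr.eval, hi, hl'] using hb.2
    · simpa [Prog.eval] using g7
    · simpa [Prog.eval, hl'] using g8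
    · simp [Prog.eval, NatExpr.eval, hi, hl']; omega
  · rw [Prog.eval_ite_neg (by
      simpa [Test.Holds, NatExpr.eval, RealExpr.eval, hi, hm, g3, hrQ, g5, layerCost,
        Finset.sum_range_succ] using hb)]
    refine ⟨⟨?_, ?_, ?_, ?_, ?_, ?_, ?_, ?_⟩, ?_⟩
    · simp [Prog.eval, NatExpr.eval, hi]; omega
    · simp [Prog.eval, NatExpr.eval, hl']; omega
    · simp [Prog.eval, NatExpr.eval, RealExpr.eval, hi, g3]
    · simp [Prog.eval, NatExpr.eval, RealExpr.eval, hi, g4]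
    · simp [Prog.eval, NatExpr.eval, RealExpr.eval, hl', g5, hB]; ring
    · simp only [Prog.eval, NatExpr.eval, hi, hl', Memory.writeNat_nat, Memory.writeReal_nat]
      simp
      linarith
    · intro x hx
      simp [Prog.eval, NatExpr.eval, hrow, hl', g7 x hx]; omega
    · intro q hq
      have hq' : q < l + 1 := by simpa [Prog.eval, NatExpr.eval, hl'] using hq
      rcases Nat.lt_or_ge q l with h | h
      · have := g8 q h
        simpa [Prog.eval, NatExpr.eval, hl', hrow, h.ne] using this
      · obtain rfl : q = l := by omega
        simp only [Prog.eval, NatExpr.eval, RealExpr.eval]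
        simp [hl', hrow, hi, g4]
        refine ⟨g1, g6, fun d hd hd' => ?_⟩
        -- A larger affordable count would make the next weight affordable, as costs are nonnegative.
        by_contra hlt
        refine hb ⟨by omega, le_trans ?_ hd'⟩
        exact mul_le_mul_of_nonneg_right (layerCost_mono hc (by omega)) (Nat.cast_nonneg _)
    · simp [Prog.eval, NatExpr.eval, hi, hl']; omega

theorem scanLayer_spec {σ : Memory} {u m Q row : ℕ} {B : ℝ} (hu : σ.nat vLayer 0 = u)
    (hm : σ.nat vSize 0 = m) (hrow : σ.nat vRow 0 = row) (hQ : σ.nat vQuanta 0 = Q)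
    (hrQ : σ.real rQuanta 0 = Q)
    (hB : σ.real rCapacity 0 = B) (hB0 : 0 ≤ B) (hc : ∀ i, 0 ≤ stepCost σ u i) :
    Exec scanLayer σ (210 * (m + Q) + 500) fun τ =>
      (∀ x < row, τ.nat aCount x = σ.nat aCount x) ∧
      ∀ q ≤ Q, MaxCount σ Q B u m q (τ.nat aCount (row + q)) ∧
        τ.real rGain q = gain (σ.real 1) (σ.nat aPerm) (τ.nat aCount (row + q)) := by
  refine .seq (Mid := fun τ => τ.nat vPos 0 = 0 ∧ τ.nat vLevel 0 = 0 ∧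
    ScanInv σ u m Q row B τ) 100 (210 * (m + Q) + 400)
    (.loopFree _ rfl (by decide) ?_) ?_ (by omega)
  · refine ⟨by simp [scanInit, Prog.eval, NatExpr.eval],
      by simp [scanInit, Prog.eval, NatExpr.eval], ?_, ?_, ?_, ?_, ?_, ?_, ?_, ?_⟩ <;>
    simp [scanInit, Prog.eval, NatExpr.eval, RealExpr.eval, layerCost, gain]
  rintro τ hF ⟨hpos, hlev, hI⟩
  refine (Exec.loop_potential (fun ρ => 210 * ((m - ρ.nat vPos 0) + (Q + 1 - ρ.nat vLevel 0)))
    (ScanInv σ u m Q row B) hI (fun ρ hG hρ hb => ⟨200, (scanStep_spec ?_ ?_ ?_ ?_ ?_ hB0 hc ?_ ?_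
      ?_ ?_ ?_ ?_ ?_ hρ).mono le_rfl ?_⟩) le_rfl).mono ?_ ?_
  · rw [hG.1 _ (by decide), hF.1 _ (by decide), hu]
  · rw [hG.1 _ (by decide), hF.1 _ (by decide), hm]
  · rw [hG.1 _ (by decide), hF.1 _ (by decide), hrow]
  · rw [hG.2 _ (by decide), hF.2 _ (by decide), hrQ]
  · rw [hG.2 _ (by decide), hF.2 _ (by decide), hB]
  · rw [hG.1 _ (by decide), hF.1 _ (by decide)]
  · rw [hG.2 _ (by decide), hF.2 _ (by decide)]
  · rw [hG.2 _ (by decide), hF.2 _ (by decide)]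
  · rw [hG.2 _ (by decide), hF.2 _ (by decide)]
  · rw [hG.2 _ (by decide), hF.2 _ (by decide)]
  · rw [hG.1 _ (by decide), hF.1 _ (by decide)]
  · have : ρ.nat vQuanta 0 = Q := by rw [hG.1 _ (by decide), hF.1 _ (by decide), hQ]
    simpa only [Test.Holds, NatExpr.eval, this] using hb
  · rintro ρ' - ⟨h1, h2⟩
    refine ⟨h1, ?_⟩
    simp only [Test.cost, NatExpr.cost]
    omega
  · simp only [Test.cost, NatExpr.cost, hpos, hlev]
    omega
  · rintro ρ hG ⟨hρ, hb⟩
    have : ρ.nat vQuanta 0 = Q := by rw [hG.1 _ (by decide), hF.1 _ (by decide), hQ]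
    simp only [Test.Holds, NatExpr.eval, this] at hb
    exact ⟨hρ.old, fun q hq => hρ.done q (by omega)⟩

/-! ### One row of the dynamic program -/

/-- The entry for `q` quanta of a row of the table is the best of all ways to split them between
the gains `v` of the current layer and the previous row `t`, and `c` is a best choice. -/
def BestSplit (t v : ℕ → ℝ) (q c : ℕ) (best : ℝ) : Prop :=
  c ≤ q ∧ best = t (q - c) + v c ∧ ∀ r ≤ q, t (q - r) + v r ≤ best

theorem tableEntry_spec {σ : Memory} {Q row q : ℕ} (hrow : σ.nat vRow 0 = row)
    (hnext : σ.nat vNext 0 = row + (Q + 1)) (hq : σ.nat vLevel 0 = q) :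
    Exec tableEntry σ (110 * q + 300) fun τ =>
      τ.nat vLevel 0 = q + 1 ∧
      (∀ x ≠ row + q, τ.nat aChoice x = σ.nat aChoice x) ∧
      (∀ x ≠ row + (Q + 1) + q, τ.real rTable x = σ.real rTable x) ∧
      BestSplit (fun x => σ.real rTable (row + x)) (σ.real rGain) q (τ.nat aChoice (row + q))
        (τ.real rTable (row + (Q + 1) + q)) := by
  let Inv : ℕ → Memory → Prop := fun t τ =>
    τ.nat vShare 0 = t + 1 ∧
      (∀ x ≠ row + q, τ.nat aChoice x = σ.nat aChoice x) ∧
      (∀ x ≠ row + (Q + 1) + q, τ.real rTable x = σ.real rTable x) ∧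
      τ.nat aChoice (row + q) ≤ t ∧
      τ.real rTable (row + (Q + 1) + q) =
        σ.real rTable (row + (q - τ.nat aChoice (row + q))) +
          σ.real rGain (τ.nat aChoice (row + q)) ∧
      ∀ r ≤ t, σ.real rTable (row + (q - r)) + σ.real rGain r ≤
        τ.real rTable (row + (Q + 1) + q)
  refine .seq (Mid := Inv 0) 100 (110 * q + 150) (.loopFree _ rfl (by decide) ?_) ?_ (by omega)
  · refine ⟨by simp [splitInit, Prog.eval, NatExpr.eval], fun x hx => ?_, fun x hx => ?_,
      ?_, ?_, fun r hr => ?_⟩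
    · simp [splitInit, Prog.eval, NatExpr.eval, hrow, hq]; omega
    · simp [splitInit, Prog.eval, NatExpr.eval, hnext, hq]; omega
    · simp [splitInit, Prog.eval, NatExpr.eval, hrow, hq]
    · simp [splitInit, Prog.eval, NatExpr.eval, RealExpr.eval, hrow, hq, hnext]
    · obtain rfl : r = 0 := by omega
      simp [splitInit, Prog.eval, NatExpr.eval, RealExpr.eval, hrow, hq, hnext]
  intro τ hF hI
  refine .seq (110 * q + 20) 50 (Exec.loop_const q 90 Inv hI ?_ ?_ ?_) ?_ (by omega)
  · rintro t ρ ht hG ⟨h1, h2, h3, h4, h5, h6⟩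
    have hrow' : ρ.nat vRow 0 = row := by rw [hG.1 _ (by decide), hF.1 _ (by decide), hrow]
    have hnext' : ρ.nat vNext 0 = row + (Q + 1) := by
      rw [hG.1 _ (by decide), hF.1 _ (by decide), hnext]
    have hq' : ρ.nat vLevel 0 = q := by rw [hG.1 _ (by decide), hF.1 _ (by decide), hq]
    have hgain : ρ.real rGain = σ.real rGain := by rw [hG.2 _ (by decide), hF.2 _ (by decide)]
    have hold : ρ.real rTable (row + (q - (t + 1))) = σ.real rTable (row + (q - (t + 1))) :=
      h3 _ (by omega)
    refine ⟨by simp only [Test.Holds, NatExpr.eval, hq', h1]; omega, ?_⟩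
    refine .loopFree _ rfl (by decide) ?_
    rw [splitStep, Prog.eval_seq]
    by_cases hb : σ.real rTable (row + (q - (t + 1))) + σ.real rGain (t + 1) ≤
        ρ.real rTable (row + (Q + 1) + q)
    · rw [Prog.eval_ite_pos (by
        simpa [Test.Holds, NatExpr.eval, RealExpr.eval, hrow', hnext', hq', h1, hold, hgain]
          using hb)]
      refine ⟨by simp [Prog.eval, NatExpr.eval, h1], by simpa [Prog.eval] using h2,
        by simpa [Prog.eval] using h3, by simp [Prog.eval]; omega, by simpa [Prog.eval] using h5,
        fun r hr => ?_⟩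
      rcases Nat.lt_or_ge r (t + 1) with h | h
      · simpa [Prog.eval] using h6 r (by omega)
      · obtain rfl : r = t + 1 := by omega
        simpa [Prog.eval] using hb
    · rw [Prog.eval_ite_neg (by
        simpa [Test.Holds, NatExpr.eval, RealExpr.eval, hrow', hnext', hq', h1, hold, hgain]
          using hb)]
      refine ⟨by simp [Prog.eval, NatExpr.eval, h1], fun x hx => ?_, fun x hx => ?_, ?_, ?_,
        fun r hr => ?_⟩
      · simp [Prog.eval, NatExpr.eval, hrow', hq', hx, h2 x hx]
      · simp [Prog.eval, NatExpr.eval, hnext', hq', hx, h3 x hx]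
      · simp [Prog.eval, NatExpr.eval, hrow', hq', h1]
      · simp [Prog.eval, NatExpr.eval, RealExpr.eval, hrow', hq', hnext', h1, hold, hgain]
      · have : σ.real rTable (row + (q - r)) + σ.real rGain r ≤
            σ.real rTable (row + (q - (t + 1))) + σ.real rGain (t + 1) := by
          rcases Nat.lt_or_ge r (t + 1) with h | h
          · exact (h6 r (by omega)).trans (not_le.1 hb).le
          · obtain rfl : r = t + 1 := by omega
            exact le_rfl
        simpa [Prog.eval, NatExpr.eval, RealExpr.eval, hrow', hq', hnext', h1, hold, hgain]
          using this
  · rintro ρ hG ⟨h1, -⟩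
    have hq' : ρ.nat vLevel 0 = q := by rw [hG.1 _ (by decide), hF.1 _ (by decide), hq]
    simp only [Test.Holds, NatExpr.eval, hq', h1]
    omega
  · simp only [Test.cost, NatExpr.cost]
    omega
  · rintro ρ hG ⟨h1, h2, h3, h4, h5, h6⟩
    have hq' : ρ.nat vLevel 0 = q := by rw [hG.1 _ (by decide), hF.1 _ (by decide), hq]
    refine .loopFree _ rfl (by decide) ⟨by simp [Prog.eval, NatExpr.eval, hq'], ?_, ?_, ?_⟩
    · simpa [Prog.eval] using h2
    · simpa [Prog.eval] using h3
    · simpa [Prog.eval, BestSplit] using (⟨h4, h5, h6⟩ : BestSplit (fun x => σ.real rTable (row + x))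
        (σ.real rGain) q (ρ.nat aChoice (row + q)) (ρ.real rTable (row + (Q + 1) + q)))

theorem tableRow_spec {σ : Memory} {Q row : ℕ} (hrow : σ.nat vRow 0 = row)
    (hQ : σ.nat vQuanta 0 = Q) :
    Exec tableRow σ (400 * (Q + 2) ^ 2) fun τ =>
      τ.nat vNext 0 = row + (Q + 1) ∧
      (∀ x < row, τ.nat aChoice x = σ.nat aChoice x) ∧
      (∀ x < row + (Q + 1), τ.real rTable x = σ.real rTable x) ∧
      ∀ q ≤ Q, BestSplit (fun x => σ.real rTable (row + x)) (σ.real rGain) q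
        (τ.nat aChoice (row + q)) (τ.real rTable (row + (Q + 1) + q)) := by
  have hsq : (Q + 1) * (110 * Q + 330) + 100 ≤ 400 * (Q + 2) ^ 2 := by nlinarith
  refine .seq (Mid := fun τ => τ.nat vNext 0 = row + (Q + 1)) 30
    ((Q + 1) * (110 * Q + 330) + 50) (.loopFree _ rfl (by decide) ?_) ?_ (by omega)
  · simp [Prog.eval, NatExpr.eval, hrow, hQ]
  intro τ₁ hF₁ hn₁
  refine .seq (Mid := fun τ => τ.nat vLevel 0 = 0) 20
    ((Q + 1) * (110 * Q + 330) + 20) (.loopFree _ rfl (by decide) ?_) ?_ (by omega)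
  · simp [Prog.eval, NatExpr.eval]
  intro τ₂ hF₂ hl₂
  have hT : τ₂.real rTable = σ.real rTable := by rw [hF₂.2 _ (by decide), hF₁.2 _ (by decide)]
  have hC : τ₂.nat aChoice = σ.nat aChoice := by rw [hF₂.1 _ (by decide), hF₁.1 _ (by decide)]
  have hQ₂ : τ₂.nat vQuanta 0 = Q := by rw [hF₂.1 _ (by decide), hF₁.1 _ (by decide), hQ]
  refine (Exec.loop_const (Q + 1) (110 * Q + 300) (fun t τ => τ.nat vLevel 0 = t ∧
      (∀ x < row, τ.nat aChoice x = σ.nat aChoice x) ∧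
      (∀ x < row + (Q + 1), τ.real rTable x = σ.real rTable x) ∧
      ∀ q < t, BestSplit (fun x => σ.real rTable (row + x)) (σ.real rGain) q
        (τ.nat aChoice (row + q)) (τ.real rTable (row + (Q + 1) + q))) ?_ ?_ ?_ le_rfl).mono ?_ ?_
  · exact ⟨hl₂, fun x _ => by rw [hC], fun x _ => by rw [hT], fun q hq => absurd hq (by omega)⟩
  · rintro t τ ht hF ⟨h1, h2, h3, h4⟩
    have hrow' : τ.nat vRow 0 = row := by
      rw [hF.1 _ (by decide), hF₂.1 _ (by decide), hF₁.1 _ (by decide), hrow]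
    have hn' : τ.nat vNext 0 = row + (Q + 1) := by
      rw [hF.1 _ (by decide), hF₂.1 _ (by decide), hn₁]
    have hQ' : τ.nat vQuanta 0 = Q := by rw [hF.1 _ (by decide), hQ₂]
    have hg' : τ.real rGain = σ.real rGain := by
      rw [hF.2 _ (by decide), hF₂.2 _ (by decide), hF₁.2 _ (by decide)]
    refine ⟨by simp only [Test.Holds, NatExpr.eval, hQ', h1]; omega, ?_⟩
    refine (tableEntry_spec hrow' hn' h1).mono (by omega) ?_
    rintro ρ - ⟨g1, g2, g3, g4⟩
    refine ⟨g1, fun x hx => by rw [g2 x (by omega), h2 x hx],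
      fun x hx => by rw [g3 x (by omega), h3 x hx], fun q hq => ?_⟩
    rcases Nat.lt_or_ge q t with h | h
    · rw [g2 _ (by omega), g3 _ (by omega)]
      exact h4 q h
    · obtain rfl : q = t := by omega
      obtain ⟨e1, e2, e3⟩ := g4
      rw [hg'] at e2 e3
      refine ⟨e1, ?_, fun r hr => ?_⟩
      · rw [e2]
        simp only
        rw [h3 _ (by omega)]
      · have := e3 r hr
        simp only at this
        rwa [h3 _ (by omega)] at this
  · rintro τ hF ⟨h1, -⟩
    have hQ' : τ.nat vQuanta 0 = Q := by rw [hF.1 _ (by decide), hQ₂]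
    simp only [Test.Holds, NatExpr.eval, hQ', h1]
    omega
  · simp only [Test.cost, NatExpr.cost]
    have : (Q + 1) * (110 * Q + 300 + (1 + 1 + (1 + 1) + 1) + 1) ≤ (Q + 1) * (110 * Q + 330) :=
      Nat.mul_le_mul_left _ (by omega)
    linarith
  · rintro τ hF ⟨h1, h2, h3, h4⟩
    refine ⟨?_, h2, h3, fun q hq => h4 q (by omega)⟩
    rw [hF.1 _ (by decide), hF₂.1 _ (by decide), hn₁]

/-! ### The loop over the layers -/

theorem BestSplit.congr {t t' v v' : ℕ → ℝ} {q c : ℕ} {best : ℝ} (h : BestSplit t v q c best)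
    (ht : ∀ x ≤ q, t x = t' x) (hv : ∀ x ≤ q, v x = v' x) : BestSplit t' v' q c best := by
  obtain ⟨h1, h2, h3⟩ := h
  refine ⟨h1, ?_, fun r hr => ?_⟩
  · rw [h2, ht _ (Nat.sub_le _ _), hv _ h1]
  · rw [← ht _ (Nat.sub_le _ _), ← hv _ hr]
    exact h3 r hr

/-- The address of the first weight of layer `u`. -/
def offset (σ : Memory) (u : ℕ) : ℕ := ∑ i ∈ Finset.range u, σ.nat 1 i

theorem offset_succ (σ : Memory) (u : ℕ) : offset σ (u + 1) = offset σ u + σ.nat 1 u :=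
  Finset.sum_range_succ _ _

theorem offset_mono (σ : Memory) {u v : ℕ} (h : u ≤ v) : offset σ u ≤ offset σ v :=
  Finset.sum_le_sum_of_subset (Finset.range_mono h)

/-- The squared norm of the first `c` weights of layer `u`, in the recorded order. -/
noncomputable def layerGain (σ : Memory) (order : ℕ → ℕ) (u c : ℕ) : ℝ :=
  gain (σ.real 1) (fun i => order (offset σ u + i)) c

/-- What the tables say about layer `u` once it has been processed: its weights are sorted, the
affordable counts are known, and its row of the dynamic program is filled in. -/
structure LayerDone (σ : Memory) (Q : ℕ) (B : ℝ) (u : ℕ) (order count choice : ℕ → ℕ)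
    (table : ℕ → ℝ) : Prop where
  perm : (slice order (offset σ u) (offset σ u + σ.nat 1 u)).Perm
    (List.range' (offset σ u) (σ.nat 1 u))
  sorted : ∀ i j, i < j → j < σ.nat 1 u →
    weightSq (σ.real 1) (order (offset σ u + j)) ≤ weightSq (σ.real 1) (order (offset σ u + i))
  count_max : ∀ q ≤ Q, MaxCount σ Q B u (σ.nat 1 u) q (count (u * (Q + 1) + q))
  split : ∀ q ≤ Q, BestSplit (fun x => table (u * (Q + 1) + x))
    (fun r => layerGain σ order u (count (u * (Q + 1) + r))) q (choice (u * (Q + 1) + q))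
    (table ((u + 1) * (Q + 1) + q))

theorem LayerDone.congr {σ : Memory} {Q : ℕ} {B : ℝ} {u i : ℕ}
    {order count choice order' count' choice' : ℕ → ℕ} {table table' : ℕ → ℝ}
    (h : LayerDone σ Q B u order count choice table) (hui : u < i)
    (ho : ∀ x < offset σ i, order' x = order x)
    (hct : ∀ x < i * (Q + 1), count' x = count x)
    (hch : ∀ x < i * (Q + 1), choice' x = choice x)
    (ht : ∀ x < i * (Q + 1) + (Q + 1), table' x = table x) :
    LayerDone σ Q B u order' count' choice' table' := by
  have h1 : offset σ u + σ.nat 1 u ≤ offset σ i := by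
    rw [← offset_succ]; exact offset_mono σ hui
  have h2 : (u + 1) * (Q + 1) ≤ i * (Q + 1) := Nat.mul_le_mul_right _ hui
  have h3 : (u + 1) * (Q + 1) = u * (Q + 1) + (Q + 1) := by ring
  have hord : ∀ j < σ.nat 1 u, order' (offset σ u + j) = order (offset σ u + j) :=
    fun j hj => ho _ (by omega)
  have hgain : ∀ q ≤ Q, layerGain σ order u (count (u * (Q + 1) + q)) =
      layerGain σ order' u (count' (u * (Q + 1) + q)) := by
    intro q hq
    rw [hct _ (by omega)]
    simp only [layerGain, gain]
    refine Finset.sum_congr rfl fun j hj => ?_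
    have := (h.count_max q hq).1
    rw [Finset.mem_range] at hj
    rw [hord j (by omega)]
  refine ⟨?_, ?_, ?_, ?_⟩
  · rw [slice_congr (g := order) fun j hj hj' => ho j (by omega)]
    exact h.perm
  · intro a b hab hb
    rw [hord a (by omega), hord b hb]
    exact h.sorted a b hab hb
  · intro q hq
    rw [hct _ (by omega)]
    exact h.count_max q hq
  · intro q hq
    rw [hch _ (by omega), ht _ (by omega)]
    exact (h.split q hq).congr (fun x hx => (ht _ (by omega)).symm)
      (fun x hx => hgain x (by omega))

/-- The loop invariant of the loop over the layers: the first `i` layers have been processed. -/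
structure LayersInv (σ : Memory) (Q : ℕ) (B : ℝ) (i : ℕ) (τ : Memory) : Prop where
  layer : τ.nat vLayer 0 = i
  off : τ.nat vOffset 0 = offset σ i
  row : τ.nat vRow 0 = i * (Q + 1)
  done : ∀ u < i, LayerDone σ Q B u (τ.nat aOrder) (τ.nat aCount) (τ.nat aChoice) (τ.real rTable)
  start : ∀ x ≤ Q, τ.real rTable x = 0

/-- The memory `τ` still holds the input `σ` and the results of the preparation. -/
structure Prepared (σ : Memory) (L Q : ℕ) (B : ℝ) (τ : Memory) : Prop where
  nat0 : τ.nat 0 = σ.nat 0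
  nat1 : τ.nat 1 = σ.nat 1
  real1 : τ.real 1 = σ.real 1
  real2 : τ.real 2 = σ.real 2
  real3 : τ.real 3 = σ.real 3
  real4 : τ.real 4 = σ.real 4
  layers : τ.nat vLayers 0 = L
  quanta : τ.nat vQuanta 0 = Q
  realQuanta : τ.real rQuanta 0 = Q
  capacity : τ.real rCapacity 0 = B

theorem Prepared.frame {p : Prog} {σ τ ρ : Memory} {L Q : ℕ} {B : ℝ} (h : Prepared σ L Q B τ)
    (hF : p.Frame τ ρ) (hn : ∀ a ∈ [0, 1, vLayers, vQuanta], a ∉ p.natWrites := by decide)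
    (hr : ∀ a ∈ [1, 2, 3, 4, rQuanta, rCapacity], a ∉ p.realWrites := by decide) :
    Prepared σ L Q B ρ := by
  simp only [List.forall_mem_cons, List.not_mem_nil, false_imp_iff, implies_true, and_true]
    at hn hr
  obtain ⟨n0, n1, n2, n3⟩ := hn
  obtain ⟨r1, r2, r3, r4, r5, r6⟩ := hr
  exact ⟨(hF.1 _ n0).trans h.nat0, (hF.1 _ n1).trans h.nat1, (hF.2 _ r1).trans h.real1,
    (hF.2 _ r2).trans h.real2, (hF.2 _ r3).trans h.real3, (hF.2 _ r4).trans h.real4,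
    by rw [hF.1 _ n2, h.layers], by rw [hF.1 _ n3, h.quanta], by rw [hF.2 _ r5, h.realQuanta],
    by rw [hF.2 _ r6, h.capacity]⟩

theorem Prepared.stepCost_eq {σ τ : Memory} {L Q : ℕ} {B : ℝ} (h : Prepared σ L Q B τ) :
    stepCost τ = stepCost σ := by
  funext u i
  simp only [stepCost, h.nat0, h.real2, h.real3, h.real4]

theorem Prepared.maxCount {σ τ : Memory} {L Q : ℕ} {B : ℝ} (h : Prepared σ L Q B τ)
    {u m q c : ℕ} (hc : MaxCount τ Q B u m q c) : MaxCount σ Q B u m q c := by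
  simpa only [MaxCount, layerCost, h.stepCost_eq] using hc

/-- A bound on the time that a layer of `m` weights takes. -/
def layerTime (Q m : ℕ) : ℕ :=
  Nat.clog 2 m * (500 * m + 250) + 500 * m + 1000 * (Q + 2) ^ 2 + 1000

theorem layerStep_spec {σ τ : Memory} {L Q i : ℕ} {B : ℝ} (hP : Prepared σ L Q B τ)
    (hB0 : 0 ≤ B) (hc : ∀ j, 0 ≤ stepCost σ i j) (hI : LayersInv σ Q B i τ) :
    Exec layerStep τ (layerTime Q (σ.nat 1 i)) (LayersInv σ Q B (i + 1)) := by
  obtain ⟨m, hm⟩ : ∃ m, σ.nat 1 i = m := ⟨_, rfl⟩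
  obtain ⟨s, hs⟩ : ∃ s, Nat.clog 2 m * (500 * m + 250) = s := ⟨_, rfl⟩
  obtain ⟨t, ht⟩ : ∃ t, (Q + 2) ^ 2 = t := ⟨_, rfl⟩
  have hQt : Q + 2 ≤ t := by rw [← ht]; nlinarith
  rw [layerTime, hm, hs, ht]
  refine .seq _ (s + 400 * m + 1000 * t + 900)
    (loadLayer_spec hI.layer hI.off (by rw [hP.nat1, hm])) ?_ (by omega)
  rintro τ₁ hF₁ ⟨hm₁, hp₁⟩
  have hP₁ := hP.frame hF₁
  refine .seq _ (400 * m + 1000 * t + 850) ((sortLayer_spec hm₁).mono (by rw [hs])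
    fun _ _ h => h) ?_ (by omega)
  rintro τ₂ hF₂ ⟨hp₂, hs₂⟩
  have hP₂ := hP₁.frame hF₂
  have hm₂ : τ₂.nat vSize 0 = m := by rw [hF₂.1 _ (by decide), hm₁]
  rw [hP₁.real1] at hs₂
  have ho₂ : τ₂.nat vOffset 0 = offset σ i := by
    rw [hF₂.1 _ (by decide), hF₁.1 _ (by decide), hI.off]
  refine .seq _ (300 * m + 1000 * t + 750) (storeLayer_spec ho₂ hm₂) ?_ (by omega)
  rintro τ₃ hF₃ ⟨hord₃, hold₃⟩
  have hP₃ := hP₂.frame hF₃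
  have hm₃ : τ₃.nat vSize 0 = m := by rw [hF₃.1 _ (by decide), hm₂]
  have hu₃ : τ₃.nat vLayer 0 = i := by
    rw [hF₃.1 _ (by decide), hF₂.1 _ (by decide), hF₁.1 _ (by decide), hI.layer]
  have hr₃ : τ₃.nat vRow 0 = i * (Q + 1) := by
    rw [hF₃.1 _ (by decide), hF₂.1 _ (by decide), hF₁.1 _ (by decide), hI.row]
  have hp₃ : τ₃.nat aPerm = τ₂.nat aPerm := hF₃.1 _ (by decide)
  refine .seq _ (790 * t + 250) (scanLayer_spec hu₃ hm₃ hr₃ hP₃.quanta hP₃.realQuanta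
    hP₃.capacity hB0 (by rw [hP₃.stepCost_eq]; exact hc)) ?_ (by omega)
  rintro τ₄ hF₄ ⟨hold₄, hcount₄⟩
  have hP₄ := hP₃.frame hF₄
  have hr₄ : τ₄.nat vRow 0 = i * (Q + 1) := by rw [hF₄.1 _ (by decide), hr₃]
  refine .seq _ 250 (tableRow_spec hr₄ hP₄.quanta) ?_ (by omega)
  rintro τ₅ hF₅ ⟨hn₅, hch₅, htab₅, hbest₅⟩
  have hP₅ := hP₄.frame hF₅
  have hm₅ : τ₅.nat vSize 0 = m := by rw [hF₅.1 _ (by decide), hF₄.1 _ (by decide), hm₃]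
  have ho₅ : τ₅.nat vOffset 0 = offset σ i := by
    rw [hF₅.1 _ (by decide), hF₄.1 _ (by decide), hF₃.1 _ (by decide), ho₂]
  have hu₅ : τ₅.nat vLayer 0 = i := by rw [hF₅.1 _ (by decide), hF₄.1 _ (by decide), hu₃]
  have hrow : (i + 1) * (Q + 1) = i * (Q + 1) + (Q + 1) := by ring
  have hord : τ₅.nat aOrder = τ₃.nat aOrder := by
    rw [hF₅.1 _ (by decide), hF₄.1 _ (by decide)]
  have hcount : τ₅.nat aCount = τ₄.nat aCount := hF₅.1 _ (by decide)
  have hold_order : ∀ x < offset σ i, τ₅.nat aOrder x = τ.nat aOrder x := fun x hx => by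
    rw [hord, hold₃ x hx, hF₂.1 _ (by decide), hF₁.1 _ (by decide)]
  have hold_count : ∀ x < i * (Q + 1), τ₅.nat aCount x = τ.nat aCount x := fun x hx => by
    rw [hcount, hold₄ x hx, hF₃.1 _ (by decide), hF₂.1 _ (by decide), hF₁.1 _ (by decide)]
  have hold_choice : ∀ x < i * (Q + 1), τ₅.nat aChoice x = τ.nat aChoice x := fun x hx => by
    rw [hch₅ x hx, hF₄.1 _ (by decide), hF₃.1 _ (by decide), hF₂.1 _ (by decide),
      hF₁.1 _ (by decide)]
  have hold_table : ∀ x < i * (Q + 1) + (Q + 1), τ₅.real rTable x = τ.real rTable x :=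
    fun x hx => by
      rw [htab₅ x hx, hF₄.2 _ (by decide), hF₃.2 _ (by decide), hF₂.2 _ (by decide),
        hF₁.2 _ (by decide)]
  have hnew : LayerDone σ Q B i (τ₅.nat aOrder) (τ₅.nat aCount) (τ₅.nat aChoice)
      (τ₅.real rTable) := by
    refine ⟨?_, ?_, ?_, ?_⟩
    · have h1 : slice (τ₅.nat aOrder) (offset σ i) (offset σ i + m) =
          slice (τ₂.nat aPerm) 0 m := by
        simp only [slice, Nat.add_sub_cancel_left, Nat.sub_zero]
        refine List.ext_getElem (by simp) fun a ha _ => ?_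
        simp only [List.length_map, List.length_range'] at ha
        simp [hord, hord₃ a ha]
      have h2 : slice (τ₁.nat aPerm) 0 m = List.range' (offset σ i) m := by
        simp only [slice, Nat.sub_zero]
        refine List.ext_getElem (by simp) fun a ha _ => ?_
        simp only [List.length_map, List.length_range'] at ha
        simp [hp₁ a ha]
      rw [hm, h1, ← h2]
      exact hp₂
    · intro a b hab hb
      rw [hm] at hb
      rw [hord, hord₃ a (by omega), hord₃ b hb]
      exact hs₂ a b hab hb
    · intro q hq
      rw [hm, hcount]
      exact hP₃.maxCount (hcount₄ q hq).1
    · intro q hq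
      rw [hrow]
      refine (hbest₅ q hq).congr (fun x hx => ?_) (fun r hr => ?_)
      · exact (htab₅ _ (by omega)).symm
      · rw [(hcount₄ r (by omega)).2, hcount, layerGain, gain, gain, hP₃.real1]
        refine Finset.sum_congr rfl fun j hj => ?_
        have := (hcount₄ r (by omega)).1.1
        rw [Finset.mem_range] at hj
        rw [hord, hord₃ j (by omega), hp₃]
  refine .loopFree _ rfl (by decide) ⟨?_, ?_, ?_, fun u hu => ?_, fun x hx => ?_⟩
  · simp [nextLayer, Prog.eval, NatExpr.eval, hu₅]
  · simp [nextLayer, Prog.eval, NatExpr.eval, ho₅, hm₅, offset_succ, hm]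
  · simp [nextLayer, Prog.eval, NatExpr.eval, hn₅, hrow]
  · have : LayerDone σ Q B u (τ₅.nat aOrder) (τ₅.nat aCount) (τ₅.nat aChoice)
        (τ₅.real rTable) := by
      rcases Nat.lt_or_ge u i with h | h
      · exact (hI.done u h).congr h hold_order hold_count hold_choice hold_table
      · obtain rfl : u = i := by omega
        exact hnew
    simpa [nextLayer, Prog.eval] using this
  · have : τ₅.real rTable x = 0 := by rw [hold_table x (by omega), hI.start x hx]
    simpa [nextLayer, Prog.eval] using this

theorem layerLoop_spec {σ τ : Memory} {L Q : ℕ} {B : ℝ} (hP : Prepared σ L Q B τ)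
    (hB0 : 0 ≤ B) (hc : ∀ i < L, ∀ j, 0 ≤ stepCost σ i j) (hI : LayersInv σ Q B 0 τ) :
    Exec layerLoop τ (∑ i ∈ Finset.range L, (layerTime Q (σ.nat 1 i) + 20) + 20)
      (LayersInv σ Q B L) := by
  refine (Exec.loop_count L (fun i => layerTime Q (σ.nat 1 i)) (LayersInv σ Q B) hI
    (fun i ρ hi hF hρ => ⟨?_, layerStep_spec (hP.frame hF) hB0 (hc i hi) hρ⟩) ?_).mono ?_ ?_
  · simp only [Test.Holds, NatExpr.eval, hρ.layer, (hP.frame hF).layers]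
    omega
  · intro ρ hF hρ
    simp only [Test.Holds, NatExpr.eval, hρ.layer, (hP.frame hF).layers]
    omega
  · refine Nat.add_le_add (Finset.sum_le_sum fun i _ => ?_) ?_ <;>
    simp only [Test.cost, NatExpr.cost] <;> omega
  · exact fun _ _ h => h

/-! ### The preparation -/

theorem prepare_spec {σ : Memory} {ε : ℝ} (hε : 0 < ε) (hε' : σ.real 0 1 = ε)
    (hn : ∀ a, 10 ≤ a → σ.nat a 0 = 0) (hr : ∀ a, 10 ≤ a → σ.real a 0 = 0)
    {L K Q : ℕ} (hL : σ.nat 0 0 + σ.nat 0 1 = L) (hK : K = ⌈1 / ε⌉₊) (hQ : Q = 1 + L * (K + 1)) :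
    Exec prepare σ (100 * K + 100 * L + 200) fun τ =>
      Prepared σ L Q (σ.real 0 0 - ∑ u ∈ Finset.range L, σ.real 5 u) τ ∧
        τ.nat vLayer 0 = 0 := by
  refine .seq (Mid := fun τ => τ.nat vLayers 0 = L ∧ τ.nat vQuanta 0 = 1 ∧ τ.real rQuanta 0 = 1 ∧
      τ.real rCapacity 0 = σ.real 0 0)
    50 (100 * K + 100 * L + 150) (.loopFree _ rfl (by decide) ?_) ?_ (by omega)
  · simp [prepareInit, Prog.eval, NatExpr.eval, RealExpr.eval, hL]
  rintro τ₁ hF₁ ⟨hL₁, hQ₁, hrQ₁, hB₁⟩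
  refine .seq (Mid := fun τ => τ.nat vGrain 0 = K ∧ τ.real rGrain 0 = K)
    (100 * K + 50) (100 * L + 100) ?_ ?_ (by omega)
  · refine (Exec.loop_const K 60 (fun t τ => τ.nat vGrain 0 = t ∧ τ.real rGrain 0 = t ∧
      τ.real rUnit 0 = t * ε) ?_ ?_ ?_ ?_).mono le_rfl ?_
    · rw [hF₁.1 _ (by decide), hF₁.2 _ (by decide), hF₁.2 _ (by decide), hn _ (by omega),
        hr _ (by omega), hr _ (by omega)]
      simp
    · rintro t τ ht hF ⟨h1, h2, h3⟩
      have h0 : τ.real 0 1 = ε := by rw [hF.2 _ (by decide), hF₁.2 _ (by decide), hε']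
      refine ⟨?_, .loopFree _ rfl (by decide) ?_⟩
      · rw [hK, Nat.lt_ceil, lt_div_iff₀ hε] at ht
        simp only [Test.Holds, RealExpr.eval, NatExpr.eval, h3, Rat.cast_one, not_le]
        exact ht
      · simp [grainStep, Prog.eval, NatExpr.eval, RealExpr.eval, h1, h2, h3, h0]
        ring
    · rintro τ hF ⟨-, -, h3⟩
      simp only [Test.Holds, RealExpr.eval, NatExpr.eval, h3, Rat.cast_one, not_not]
      rw [← div_le_iff₀ hε, hK]
      exact Nat.le_ceil _
    · simp only [Test.cost, NatExpr.cost, RealExpr.cost]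
      omega
    · exact fun τ _ h => ⟨h.1, h.2.1⟩
  rintro τ₂ hF₂ ⟨hg₂, hrg₂⟩
  refine .seq (Mid := fun τ => τ.nat vQuanta 0 = Q ∧ τ.real rQuanta 0 = Q ∧
      τ.real rCapacity 0 = σ.real 0 0 - ∑ u ∈ Finset.range L, σ.real 5 u)
    (100 * L + 50) 50 ?_ ?_ (by omega)
  · refine (Exec.loop_const L 80 (fun t τ => τ.nat vLayer 0 = t ∧
      τ.nat vQuanta 0 = 1 + t * (K + 1) ∧ τ.real rQuanta 0 = 1 + t * (K + 1) ∧
      τ.real rCapacity 0 = σ.real 0 0 - ∑ u ∈ Finset.range t, σ.real 5 u) ?_ ?_ ?_ ?_).mono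
      le_rfl ?_
    · refine ⟨?_, ?_, ?_, ?_⟩
      · rw [hF₂.1 _ (by decide), hF₁.1 _ (by decide), hn _ (by omega)]
      · rw [hF₂.1 _ (by decide), hQ₁]; simp
      · rw [hF₂.2 _ (by decide), hrQ₁]; simp
      · rw [hF₂.2 _ (by decide), hB₁]; simp
    · rintro t τ ht hF ⟨h1, h2, h3, h4⟩
      have hL' : τ.nat vLayers 0 = L := by rw [hF.1 _ (by decide), hF₂.1 _ (by decide), hL₁]
      have hg' : τ.nat vGrain 0 = K := by rw [hF.1 _ (by decide), hg₂]
      have hrg' : τ.real rGrain 0 = K := by rw [hF.2 _ (by decide), hrg₂]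
      have h5 : τ.real 5 = σ.real 5 := by
        rw [hF.2 _ (by decide), hF₂.2 _ (by decide), hF₁.2 _ (by decide)]
      refine ⟨by simp only [Test.Holds, NatExpr.eval, hL', h1]; omega,
        .loopFree _ rfl (by decide) ⟨?_, ?_, ?_, ?_⟩⟩
      · simp [quantaStep, Prog.eval, NatExpr.eval, h1]
      · simp [quantaStep, Prog.eval, NatExpr.eval, h2, hg']; ring
      · simp [quantaStep, Prog.eval, RealExpr.eval, NatExpr.eval, h3, hrg']; ring
      · simp [quantaStep, Prog.eval, RealExpr.eval, NatExpr.eval, h1, h4, h5,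
          Finset.sum_range_succ]
        ring
    · rintro τ hF ⟨h1, -⟩
      have hL' : τ.nat vLayers 0 = L := by rw [hF.1 _ (by decide), hF₂.1 _ (by decide), hL₁]
      simp only [Test.Holds, NatExpr.eval, hL', h1]
      omega
    · simp only [Test.cost, NatExpr.cost]
      omega
    · rintro τ - ⟨-, h2, h3, h4⟩
      exact ⟨by rw [h2, hQ], by rw [h3, hQ]; push_cast; ring, h4⟩
  rintro τ₃ hF₃ ⟨hQ₃, hrQ₃, hB₃⟩
  refine .loopFree _ rfl (by decide) ⟨⟨?_, ?_, ?_, ?_, ?_, ?_, ?_, ?_, ?_, ?_⟩, ?_⟩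
  · rw [← hF₁.1 _ (by decide), ← hF₂.1 _ (by decide), ← hF₃.1 _ (by decide)]
    simp [Prog.eval]
  · rw [← hF₁.1 _ (by decide), ← hF₂.1 _ (by decide), ← hF₃.1 _ (by decide)]
    simp [Prog.eval]
  · rw [← hF₁.2 _ (by decide), ← hF₂.2 _ (by decide), ← hF₃.2 _ (by decide)]
    simp [Prog.eval]
  · rw [← hF₁.2 _ (by decide), ← hF₂.2 _ (by decide), ← hF₃.2 _ (by decide)]
    simp [Prog.eval]
  · rw [← hF₁.2 _ (by decide), ← hF₂.2 _ (by decide), ← hF₃.2 _ (by decide)]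
    simp [Prog.eval]
  · rw [← hF₁.2 _ (by decide), ← hF₂.2 _ (by decide), ← hF₃.2 _ (by decide)]
    simp [Prog.eval]
  · have : τ₃.nat vLayers 0 = L := by rw [hF₃.1 _ (by decide), hF₂.1 _ (by decide), hL₁]
    simpa [Prog.eval] using this
  · simpa [Prog.eval] using hQ₃
  · simpa [Prog.eval] using hrQ₃
  · simpa [Prog.eval] using hB₃
  · simp [Prog.eval, NatExpr.eval]

/-! ### Optimality of the dynamic program -/

section Optimality

variable {σ : Memory} {L Q : ℕ} {B : ℝ} {order count choice : ℕ → ℕ} {table : ℕ → ℝ}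

/-- The entry of the table for the first `i` layers and `q` quanta is at least the value of every way
to divide at most `q` quanta among these layers. -/
theorem sum_layerGain_le_table
    (hd : ∀ u < L, LayerDone σ Q B u order count choice table) (h0 : ∀ x ≤ Q, table x = 0)
    (r : ℕ → ℕ) {i q : ℕ} (hi : i ≤ L) (hq : q ≤ Q) (hr : ∑ u ∈ Finset.range i, r u ≤ q) :
    ∑ u ∈ Finset.range i, layerGain σ order u (count (u * (Q + 1) + r u)) ≤
      table (i * (Q + 1) + q) := by
  induction i generalizing q with
  | zero => simp [h0 q hq]
  | succ i ih =>
    rw [Finset.sum_range_succ] at hr ⊢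
    have h1 := ih (q := q - r i) (by omega) (by omega) (by omega)
    have h2 := ((hd i (by omega)).split q hq).2.2 (r i) (by omega)
    linarith

theorem layerGain_mono (u : ℕ) {c d : ℕ} (h : c ≤ d) :
    layerGain σ order u c ≤ layerGain σ order u d :=
  Finset.sum_le_sum_of_subset_of_nonneg (Finset.range_mono h) fun _ _ _ => mul_self_nonneg _

/-- Every choice of counts whose energy is smaller than the capacity by the factor `1 + ε` is
matched by the dynamic program: rounding the share of each layer up to an integer number of quanta
costs less than one quantum per layer, and there are enough quanta for that. -/
theorem sum_layerGain_le_of_slack {ε : ℝ} (hε : 0 < ε)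
    (hd : ∀ u < L, LayerDone σ Q B u order count choice table) (h0 : ∀ x ≤ Q, table x = 0)
    (hB : 0 ≤ B) (hc : ∀ u < L, ∀ j, 0 ≤ stepCost σ u j)
    (hQ : (L : ℝ) * (1 + ε) ≤ Q * ε) (M : ℕ → ℕ) (hM : ∀ u < L, M u ≤ σ.nat 1 u)
    (hcost : (∑ u ∈ Finset.range L, layerCost σ u (M u)) * (1 + ε) ≤ B) :
    ∑ u ∈ Finset.range L, layerGain σ order u (M u) ≤ table (L * (Q + 1) + Q) := by
  have hcost0 : ∀ u ∈ Finset.range L, 0 ≤ layerCost σ u (M u) := fun u hu =>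
    Finset.sum_nonneg fun j _ => hc u (Finset.mem_range.1 hu) j
  set S := ∑ u ∈ Finset.range L, layerCost σ u (M u) with hS
  have hS0 : 0 ≤ S := Finset.sum_nonneg hcost0
  let r : ℕ → ℕ := fun u => ⌈layerCost σ u (M u) * Q / B⌉₊
  have hr : ∀ u < L, layerCost σ u (M u) * Q ≤ r u * B := by
    intro u hu
    -- If the capacity is zero, then `r u = 0` by the convention for division by zero, and the
    -- slack condition forces all energies to vanish.
    rcases hB.eq_or_lt with hB0 | hB0
    · have h1 : S = 0 := by
        refine le_antisymm ?_ hS0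
        rw [← hB0] at hcost
        exact nonpos_of_mul_nonpos_left hcost (by linarith)
      have h2 := (Finset.sum_eq_zero_iff_of_nonneg hcost0).1 h1 u (Finset.mem_range.2 hu)
      rw [h2, ← hB0]
      simp
    · rw [← div_le_iff₀ hB0]
      exact Nat.le_ceil _
  have hsum : ∑ u ∈ Finset.range L, r u ≤ Q := by
    have hr' : ∀ u ∈ Finset.range L, (r u : ℝ) ≤ layerCost σ u (M u) * Q / B + 1 := fun u hu =>
      (Nat.ceil_lt_add_one (div_nonneg (mul_nonneg (hcost0 u hu) (Nat.cast_nonneg _)) hB)).le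
    have h1 := Finset.sum_le_sum hr'
    rw [Finset.sum_add_distrib, ← Finset.sum_div, ← Finset.sum_mul, ← hS] at h1
    simp only [Finset.sum_const, Finset.card_range, nsmul_eq_mul, mul_one] at h1
    have hLQ : (L : ℝ) ≤ Q := by
      have : (L : ℝ) * ε ≤ Q * ε := by
        have : (0 : ℝ) ≤ L := Nat.cast_nonneg _
        nlinarith
      exact le_of_mul_le_mul_right this hε
    have h2 : S * Q / B ≤ Q - L := by
      refine div_le_of_le_mul₀ hB (by linarith) ?_
      calc S * Q ≤ S * ((1 + ε) * (Q - L)) :=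
            mul_le_mul_of_nonneg_left (by linarith) hS0
        _ = (Q - L) * (S * (1 + ε)) := by ring
        _ ≤ (Q - L) * B := mul_le_mul_of_nonneg_left hcost (by linarith)
    have h3 : ((∑ u ∈ Finset.range L, r u : ℕ) : ℝ) ≤ Q := by
      push_cast
      linarith
    exact_mod_cast h3
  refine le_trans (Finset.sum_le_sum fun u hu => ?_)
    (sum_layerGain_le_table hd h0 r le_rfl le_rfl hsum)
  have hrQ : r u ≤ Q := (Finset.single_le_sum (fun _ _ => Nat.zero_le _) hu).trans hsum
  rw [Finset.mem_range] at hu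
  exact layerGain_mono u (((hd u hu).count_max (r u) hrQ).2.2 (M u) (hM u hu) (hr u hu))

end Optimality

/-! ### Tracing back the choices -/

open Classical in
theorem outLoop_spec {σ : Memory} {o h : ℕ} (ho : σ.nat vOffset 0 = o) (hh : σ.nat vHi 0 = h)
    (hpos : σ.nat vPos 0 = 0) :
    Exec outLoop σ (100 * h + 50) fun τ => ∀ y, τ.real rOut y =
      if ∃ i < h, σ.nat aOrder (o + i) = y then σ.real 1 y else σ.real rOut y := by
  refine (Exec.loop_const h 50 (fun t τ => τ.nat vPos 0 = t ∧ ∀ y, τ.real rOut y =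
      if ∃ i < t, σ.nat aOrder (o + i) = y then σ.real 1 y else σ.real rOut y)
    ⟨hpos, fun y => by simp⟩ ?_ ?_ le_rfl).mono ?_ ?_
  · rintro t τ ht hF ⟨h1, h2⟩
    have hh' : τ.nat vHi 0 = h := by rw [hF.1 _ (by decide), hh]
    have ho' : τ.nat vOffset 0 = o := by rw [hF.1 _ (by decide), ho]
    have hr' : τ.nat aOrder = σ.nat aOrder := hF.1 _ (by decide)
    have hZ' : τ.real 1 = σ.real 1 := hF.2 _ (by decide)
    refine ⟨by simp only [Test.Holds, NatExpr.eval, hh', h1]; omega, ?_⟩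
    refine .loopFree _ rfl (by decide) ⟨by simp [outStep, Prog.eval, NatExpr.eval, h1], ?_⟩
    intro y
    have hval : (outStep.eval τ).real rOut y =
        if y = σ.nat aOrder (o + t) then σ.real 1 (σ.nat aOrder (o + t)) else τ.real rOut y := by
      simp [outStep, Prog.eval, NatExpr.eval, RealExpr.eval, h1, ho', hr', hZ']
    rw [hval, h2 y]
    by_cases hy : y = σ.nat aOrder (o + t)
    · rw [if_pos hy, if_pos ⟨t, by omega, hy.symm⟩, hy]
    · rw [if_neg hy]
      refine if_congr ⟨fun ⟨i, hi, hi'⟩ => ⟨i, by omega, hi'⟩, fun ⟨i, hi, hi'⟩ => ⟨i, ?_, hi'⟩⟩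
        rfl rfl
      have : i ≠ t := fun h => hy (by rw [← hi', h])
      omega
  · rintro τ hF ⟨h1, -⟩
    have hh' : τ.nat vHi 0 = h := by rw [hF.1 _ (by decide), hh]
    simp only [Test.Holds, NatExpr.eval, hh', h1]
    omega
  · simp only [Test.cost, NatExpr.cost]
    omega
  · exact fun _ _ h => h.2

open Classical in
/-- The invariant of the traceback: for the layers from `u` on, the counts `M` have been chosen,
their energy is paid by the quanta that are already used, and together with the entry of the table
for the remaining quanta and layers they attain the optimum. -/
structure TraceInv (σ : Memory) (L Q : ℕ) (B : ℝ) (order : ℕ → ℕ) (table : ℕ → ℝ) (u : ℕ)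
    (M : ℕ → ℕ) (τ : Memory) : Prop where
  layer : τ.nat vLayer 0 = u
  off : τ.nat vOffset 0 = offset σ u
  row : τ.nat vRow 0 = u * (Q + 1)
  rest_le : τ.nat vRest 0 ≤ Q
  le_size : ∀ v, u ≤ v → v < L → M v ≤ σ.nat 1 v
  cost_le : (∑ v ∈ Finset.Ico u L, layerCost σ v (M v)) * Q ≤ (Q - τ.nat vRest 0 : ℝ) * B
  value : table (L * (Q + 1) + Q) = table (u * (Q + 1) + τ.nat vRest 0) +
    ∑ v ∈ Finset.Ico u L, layerGain σ order v (M v)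
  out : ∀ y, τ.real rOut y =
    if ∃ v, u ≤ v ∧ v < L ∧ ∃ i < M v, order (offset σ v + i) = y then σ.real 1 y else 0

theorem traceStep_spec {σ τ : Memory} {L Q u : ℕ} {B : ℝ} {order count choice : ℕ → ℕ}
    {table : ℕ → ℝ} {M : ℕ → ℕ} (hP : Prepared σ L Q B τ) (hu : u < L)
    (hd : LayerDone σ Q B u order count choice table)
    (hord : τ.nat aOrder = order) (hcount : τ.nat aCount = count) (hchoice : τ.nat aChoice = choice)
    (hI : TraceInv σ L Q B order table (u + 1) M τ) :
    Exec traceStep τ (200 + 100 * σ.nat 1 u) fun ρ =>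
      ∃ M', TraceInv σ L Q B order table u M' ρ := by
  classical
  obtain ⟨h1, h2, h3, h4, h5, h6, h7, h8⟩ := hI
  obtain ⟨q, hq⟩ : ∃ q, τ.nat vRest 0 = q := ⟨_, rfl⟩
  rw [hq] at h4 h6 h7
  obtain ⟨b1, b2, -⟩ := hd.split q h4
  obtain ⟨c, hc⟩ : ∃ c, choice (u * (Q + 1) + q) = c := ⟨_, rfl⟩
  rw [hc] at b1 b2
  beta_reduce at b2
  obtain ⟨m, hm⟩ : ∃ m, count (u * (Q + 1) + c) = m := ⟨_, rfl⟩
  obtain ⟨m1, m2, -⟩ := hd.count_max c (by omega)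
  rw [hm] at m1 m2
  have hrow : (u + 1) * (Q + 1) = u * (Q + 1) + (Q + 1) := by ring
  refine .seq (Mid := fun ρ => ρ.nat vLayer 0 = u ∧ ρ.nat vOffset 0 = offset σ u ∧
    ρ.nat vRow 0 = u * (Q + 1) ∧ ρ.nat vRest 0 = q - c ∧ ρ.nat vHi 0 = m ∧ ρ.nat vPos 0 = 0)
    100 (100 + 100 * σ.nat 1 u) (.loopFree _ rfl (by decide) ?_) ?_ (by omega)
  · simp [traceInit, Prog.eval, NatExpr.eval, h1, h2, h3, hq, offset_succ, hP.nat1, hP.quanta,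
      hrow, hcount, hchoice, hc, hm]
  rintro τ₁ hF₁ ⟨g1, g2, g3, g4, g5, g6⟩
  refine (outLoop_spec g2 g5 g6).mono (by omega) ?_
  intro τ₂ hF₂ hout
  have hM : ∀ v, u + 1 ≤ v → Function.update M u m v = M v := fun v hv =>
    Function.update_of_ne (by omega) _ _
  have hrest : τ₂.nat vRest 0 = q - c := by rw [hF₂.1 _ (by decide), g4]
  refine ⟨Function.update M u m, ?_, ?_, ?_, ?_, ?_, ?_, ?_, ?_⟩
  · rw [hF₂.1 _ (by decide), g1]
  · rw [hF₂.1 _ (by decide), g2]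
  · rw [hF₂.1 _ (by decide), g3]
  · rw [hrest]; omega
  · intro v hv hv'
    rcases hv.eq_or_lt with rfl | hv
    · simpa using m1
    · rw [hM v hv]
      exact h5 v hv hv'
  · rw [Finset.sum_eq_sum_Ico_succ_bot hu, Function.update_self, hrest, Nat.cast_sub b1,
      Finset.sum_congr rfl fun v hv => by rw [hM v (Finset.mem_Ico.1 hv).1]]
    linarith
  · rw [Finset.sum_eq_sum_Ico_succ_bot hu, Function.update_self, hrest,
      Finset.sum_congr rfl fun v hv => by rw [hM v (Finset.mem_Ico.1 hv).1]]
    rw [h7, b2, hm]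
    ring
  · intro y
    have e1 : τ₁.nat aOrder = order := by rw [hF₁.1 _ (by decide), hord]
    have e2 : τ₁.real 1 = σ.real 1 := by rw [hF₁.2 _ (by decide), hP.real1]
    have e3 : τ₁.real rOut = τ.real rOut := hF₁.2 _ (by decide)
    rw [hout y, e1, e2, e3, h8 y]
    by_cases hy : ∃ i < m, order (offset σ u + i) = y
    · rw [if_pos hy, if_pos ⟨u, le_rfl, hu, by simpa using hy⟩]
    · rw [if_neg hy]
      refine if_congr ⟨?_, ?_⟩ rfl rfl
      · rintro ⟨v, hv, hv', hi⟩
        exact ⟨v, by omega, hv', by rwa [hM v hv]⟩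
      · rintro ⟨v, hv, hv', hi⟩
        rcases hv.eq_or_lt with rfl | hv
        · exact absurd (by simpa using hi) hy
        · exact ⟨v, hv, hv', by rwa [hM v hv] at hi⟩

theorem traceLoop_spec {σ τ : Memory} {L Q : ℕ} {B : ℝ} {order count choice : ℕ → ℕ}
    {table : ℕ → ℝ} (hP : Prepared σ L Q B τ)
    (hd : ∀ u < L, LayerDone σ Q B u order count choice table)
    (hord : τ.nat aOrder = order) (hcount : τ.nat aCount = count) (hchoice : τ.nat aChoice = choice)
    (hI : TraceInv σ L Q B order table L 0 τ) :
    Exec traceLoop τ (∑ u ∈ Finset.range L, (100 * σ.nat 1 u + 210) + 20) fun ρ =>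
      ∃ M, TraceInv σ L Q B order table 0 M ρ := by
  have h := Exec.loop_count (b := .natLe (.lit 1) (.var vLayer)) (p := traceStep) (σ := τ) L
    (fun i => 200 + 100 * σ.nat 1 (L - 1 - i))
    (fun i ρ => ∃ M, TraceInv σ L Q B order table (L - i) M ρ) ⟨0, hI⟩ ?_ ?_
  · refine h.mono ?_ fun ρ _ hρ => by simpa using hρ
    rw [← Finset.sum_range_reflect (fun u => 100 * σ.nat 1 u + 210)]
    refine Nat.add_le_add (Finset.sum_le_sum fun i _ => ?_) ?_ <;>
    simp only [Test.cost, NatExpr.cost] <;> omega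
  · rintro i ρ hi hF ⟨M, hρ⟩
    refine ⟨?_, ?_⟩
    · simp only [Test.Holds, NatExpr.eval, hρ.layer]
      omega
    · have hL : L - i = (L - 1 - i) + 1 := by omega
      rw [hL] at hρ
      have := traceStep_spec (hP.frame hF) (by omega) (hd (L - 1 - i) (by omega))
        (by rw [hF.1 _ (by decide), hord]) (by rw [hF.1 _ (by decide), hcount])
        (by rw [hF.1 _ (by decide), hchoice]) hρ
      rw [show L - (i + 1) = L - 1 - i by omega]
      exact this
  · rintro ρ - ⟨M, hρ⟩
    simp only [Test.Holds, NatExpr.eval, hρ.layer]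
    omega

/-! ### The whole program -/

/-- A bound on the running time of the program, for `L` layers and `K = ⌈1/ε⌉`. -/
def programTime (σ : Memory) (L K Q : ℕ) : ℕ :=
  100 * K + 100 * L + 500 + (∑ u ∈ Finset.range L, (layerTime Q (σ.nat 1 u) + 20) +
    ∑ u ∈ Finset.range L, (100 * σ.nat 1 u + 210))

open Classical in
theorem program_spec {σ : Memory} {ε : ℝ} (hε : 0 < ε) (hε' : σ.real 0 1 = ε)
    (hn : ∀ a, 10 ≤ a → σ.nat a 0 = 0) (hr : ∀ a, 10 ≤ a → σ.real a 0 = 0)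
    (hout : ∀ x, σ.real rOut x = 0) (htable : ∀ x, σ.real rTable x = 0)
    {L K Q : ℕ} (hL : σ.nat 0 0 + σ.nat 0 1 = L) (hK : K = ⌈1 / ε⌉₊) (hQ : Q = 1 + L * (K + 1))
    {B : ℝ} (hB : B = σ.real 0 0 - ∑ u ∈ Finset.range L, σ.real 5 u) (hB0 : 0 ≤ B)
    (hc : ∀ u < L, ∀ j, 0 ≤ stepCost σ u j) :
    Exec program σ (programTime σ L K Q) fun τ => ∃ (order M : ℕ → ℕ),
      (∀ u < L, (slice order (offset σ u) (offset σ u + σ.nat 1 u)).Perm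
          (List.range' (offset σ u) (σ.nat 1 u)) ∧
        (∀ i j, i < j → j < σ.nat 1 u →
          weightSq (σ.real 1) (order (offset σ u + j)) ≤ weightSq (σ.real 1) (order (offset σ u + i))) ∧
        M u ≤ σ.nat 1 u) ∧
      ∑ u ∈ Finset.range L, layerCost σ u (M u) ≤ B ∧
      (∀ M' : ℕ → ℕ, (∀ u < L, M' u ≤ σ.nat 1 u) →
        (∑ u ∈ Finset.range L, layerCost σ u (M' u)) * (1 + ε) ≤ B →
        ∑ u ∈ Finset.range L, layerGain σ order u (M' u) ≤
          ∑ u ∈ Finset.range L, layerGain σ order u (M u)) ∧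
      ∀ y, τ.real rOut y =
        if ∃ u < L, ∃ i < M u, order (offset σ u + i) = y then σ.real 1 y else 0 := by
  have hQε : (L : ℝ) * (1 + ε) ≤ Q * ε := by
    have h1 : 1 ≤ K * ε := by
      rw [← div_le_iff₀ hε, hK]
      exact Nat.le_ceil _
    rw [hQ]
    push_cast
    have : (0 : ℝ) ≤ L := Nat.cast_nonneg _
    nlinarith
  -- The extra quantum keeps `Q` positive if there are no layers.
  have hQ0 : (0 : ℝ) < Q := by
    rw [hQ]
    positivity
  refine .seq _ (300 + (∑ u ∈ Finset.range L, (layerTime Q (σ.nat 1 u) + 20) +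
    ∑ u ∈ Finset.range L, (100 * σ.nat 1 u + 210)))
    (prepare_spec hε hε' hn hr hL hK hQ) ?_ (by rw [programTime]; omega)
  rintro τ₁ hF₁ ⟨hP₁, hl₁⟩
  rw [← hB] at hP₁
  refine .seq _ (100 + ∑ u ∈ Finset.range L, (100 * σ.nat 1 u + 210))
    (layerLoop_spec hP₁ hB0 hc ⟨hl₁, ?_, ?_, ?_, ?_⟩) ?_ (by omega)
  · rw [hF₁.1 _ (by decide), hn _ (by omega)]; simp [offset]
  · rw [hF₁.1 _ (by decide), hn _ (by omega)]; simp
  · intro u hu; omega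
  · intro x _
    rw [hF₁.2 _ (by decide), htable]
  intro τ₂ hF₂ hI₂
  have hP₂ := hP₁.frame hF₂
  refine .seq (Mid := fun τ => TraceInv σ L Q B (τ₂.nat aOrder) (τ₂.real rTable) L 0 τ ∧
      τ.nat aOrder = τ₂.nat aOrder ∧ τ.nat aCount = τ₂.nat aCount ∧
      τ.nat aChoice = τ₂.nat aChoice) 20 (80 + ∑ u ∈ Finset.range L, (100 * σ.nat 1 u + 210))
    (.loopFree _ rfl (by decide) ⟨?_, ?_, ?_, ?_⟩) ?_ (by omega)
  · have hrest : (Prog.eval (.letNat vRest (.var vQuanta)) τ₂).nat vRest 0 = Q := by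
      simp [Prog.eval, NatExpr.eval, hP₂.quanta]
    refine ⟨?_, ?_, ?_, hrest.le, ?_, ?_, ?_, fun y => ?_⟩
    · simp [Prog.eval, hI₂.layer]
    · simp [Prog.eval, hI₂.off]
    · simp [Prog.eval, hI₂.row]
    · intro v h1 h2; omega
    · simp [hrest]
    · simp [hrest]
    · rw [if_neg (by rintro ⟨v, h1, h2, -⟩; omega)]
      have : τ₂.real rOut y = 0 := by rw [hF₂.2 _ (by decide), hF₁.2 _ (by decide), hout]
      simpa [Prog.eval] using this
  · simp [Prog.eval]
  · simp [Prog.eval]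
  · simp [Prog.eval]
  rintro τ₃ hF₃ ⟨hI₃, ho₃, hc₃, hch₃⟩
  refine (traceLoop_spec (hP₂.frame hF₃) hI₂.done ho₃ hc₃ hch₃ hI₃).mono (by omega) ?_
  rintro τ₄ - ⟨M, hM⟩
  have hval : ∑ u ∈ Finset.range L, layerGain σ (τ₂.nat aOrder) u (M u) =
      τ₂.real rTable (L * (Q + 1) + Q) := by
    rw [hM.value, Nat.zero_mul, Nat.zero_add, hI₂.start _ hM.rest_le, zero_add,
      Finset.range_eq_Ico]
  refine ⟨τ₂.nat aOrder, M, fun u hu => ⟨(hI₂.done u hu).perm, (hI₂.done u hu).sorted,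
    hM.le_size u (Nat.zero_le _) hu⟩, ?_, fun M' h1 h2 => ?_, fun y => ?_⟩
  · have := hM.cost_le
    rw [← Finset.range_eq_Ico] at this
    refine le_of_mul_le_mul_right (this.trans ?_) hQ0
    rw [mul_comm B]
    exact mul_le_mul_of_nonneg_right (by simp) hB0
  · rw [hval]
    exact sum_layerGain_le_of_slack hε hI₂.done hI₂.start hB0 hc hQε M' h1 h2
  · rw [hM.out y]
    exact if_congr ⟨fun ⟨v, _, h⟩ => ⟨v, h⟩, fun ⟨v, h⟩ => ⟨v, Nat.zero_le _, h⟩⟩ rfl rfl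

end Projection
end RealRAM

/-! ### The largest sums of squares within a layer -/

theorem Fin.val_le_of_strictMono {c m : ℕ} {f : Fin c → Fin m} (hf : StrictMono f) (i : Fin c) :
    (i : ℕ) ≤ f i := by
  obtain ⟨i, hi⟩ := i
  induction i with
  | zero => exact Nat.zero_le _
  | succ i ih =>
    have h1 := ih (by omega)
    have h2 : f ⟨i, by omega⟩ < f ⟨i + 1, hi⟩ := hf (by simp)
    rw [Fin.lt_def] at h2
    simp only at h1 ⊢
    omega

/-- If `e` sorts the values `z` in decreasing order, then no `c` of them have a sum larger than
the first `c`. -/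
theorem Finset.sum_le_sum_range_card_of_sorted {m : ℕ} {z : Fin m → ℝ} {e : Equiv.Perm (Fin m)}
    {g : ℕ → ℝ} (hg : ∀ i : Fin m, g i = z (e i))
    (hs : ∀ i j, i < j → j < m → g j ≤ g i) (T : Finset (Fin m)) :
    ∑ j ∈ T, z j ≤ ∑ i ∈ Finset.range T.card, g i := by
  have h1 : ∑ j ∈ T, z j = ∑ i ∈ T.map e.symm.toEmbedding, z (e i) := by
    simp
  have hcard : (T.map e.symm.toEmbedding).card = T.card := Finset.card_map _
  rw [h1, Finset.sum_range]
  generalize hT : T.map e.symm.toEmbedding = T' at *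
  have h2 : ∑ i ∈ T', z (e i) = ∑ i : Fin T.card, z (e (T'.orderEmbOfFin hcard i)) := by
    have := Finset.sum_map Finset.univ (T'.orderEmbOfFin hcard).toEmbedding (fun i => z (e i))
    rw [Finset.map_orderEmbOfFin_univ] at this
    exact this
  rw [h2]
  refine Finset.sum_le_sum fun i _ => ?_
  rw [← hg]
  have h3 := Fin.val_le_of_strictMono (T'.orderEmbOfFin hcard).strictMono i
  rcases h3.eq_or_lt with h | h
  · rw [← h]
  · exact hs _ _ h (Fin.is_lt _)

theorem Finset.sum_filter_symm_lt {m c : ℕ} (hc : c ≤ m) {z : Fin m → ℝ} {e : Equiv.Perm (Fin m)}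
    {g : ℕ → ℝ} (hg : ∀ i : Fin m, g i = z (e i)) :
    ∑ j with (e.symm j : ℕ) < c, z j = ∑ i ∈ Finset.range c, g i := by
  have h1 : ∑ j with (e.symm j : ℕ) < c, z j =
      ∑ i : Fin m, if (i : ℕ) < c then g i else 0 := by
    rw [Finset.sum_filter, ← Equiv.sum_comp e]
    exact Finset.sum_congr rfl fun i _ => by rw [hg, Equiv.symm_apply_apply]
  rw [h1, ← Finset.sum_range fun i => if i < c then g i else 0, ← Finset.sum_filter]
  refine Finset.sum_congr (Finset.ext fun i => ?_) fun _ _ => rfl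
  simp only [Finset.mem_filter, Finset.mem_range]
  omega

theorem RealRAM.exists_perm_of_slice_perm {order : ℕ → ℕ} {o m : ℕ}
    (h : (RealRAM.slice order o (o + m)).Perm (List.range' o m)) :
    ∃ e : Equiv.Perm (Fin m), ∀ i : Fin m, order (o + i) = o + e i := by
  rw [slice, Nat.add_sub_cancel_left] at h
  have hmem : ∀ i < m, o ≤ order (o + i) ∧ order (o + i) < o + m := by
    intro i hi
    have : order (o + i) ∈ List.range' o m :=
      h.subset (List.mem_map_of_mem (List.mem_range'_1.2 ⟨by omega, by omega⟩))
    exact List.mem_range'_1.1 this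
  have hnd : ((List.range' o m).map order).Nodup := h.nodup_iff.2 List.nodup_range'
  have hinj : Function.Injective fun i : Fin m =>
      (⟨order (o + i) - o, by have := hmem i i.2; omega⟩ : Fin m) := by
    intro i j hij
    have h1 := hmem i i.2
    have h2 := hmem j j.2
    simp only [Fin.mk.injEq] at hij
    have h3 := List.inj_on_of_nodup_map hnd (x := o + i)
      (List.mem_range'_1.2 ⟨by omega, by omega⟩) (y := o + j)
      (List.mem_range'_1.2 ⟨by omega, by omega⟩) (by omega)
    exact Fin.ext (by omega)
  refine ⟨Equiv.ofBijective _ (Finite.injective_iff_bijective.1 hinj), fun i => ?_⟩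
  have := hmem i i.2
  simp only [Equiv.ofBijective_apply]
  omega

/-! ### The input memory -/

namespace EnergyProblem

open RealRAM RealRAM.Projection

variable (P : EnergyProblem) (ε : ℝ)

theorem input_nat_size (u : P.Layer) : (P.input ε).nat 1 u = P.size u := by
  simp [input, u.2]

theorem offset_add (x : P.Idx) :
    offset (P.input ε) x.1 + x.2 = (finSigmaFinEquiv x : Fin (∑ u, P.size u)) := by
  rw [finSigmaFinEquiv_apply, offset, Finset.sum_range]
  congr 1
  refine Finset.sum_congr rfl fun i _ => ?_
  exact P.input_nat_size ε ⟨i, i.2.trans x.1.2⟩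

theorem input_real_weight (x : P.Idx) :
    (P.input ε).real 1 (offset (P.input ε) x.1 + x.2) = P.Z x := by
  have h : ∀ y : Fin (∑ u, P.size u), (P.input ε).real 1 y = P.Z (finSigmaFinEquiv.symm y) :=
    fun y => by simp [input]
  rw [offset_add, h, Equiv.symm_apply_apply]

theorem layerCost_input (u : P.Layer) (c : ℕ) :
    layerCost (P.input ε) u c =
      P.α₁ u * min (P.k : ℝ) c + P.α₂ u * max 0 ((c : ℝ) - P.k) + P.α₃ u * c := by
  induction c with
  | zero => simp [layerCost]
  | succ c ih =>
    rw [layerCost, Finset.sum_range_succ, ← layerCost, ih, stepCost]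
    have h0 : (P.input ε).nat 0 2 = P.k := rfl
    have h2 : (P.input ε).real 2 u = P.α₁ u := by simp [input, u.2]
    have h3 : (P.input ε).real 3 u = P.α₂ u := by simp [input, u.2]
    have h4 : (P.input ε).real 4 u = P.α₃ u := by simp [input, u.2]
    rw [h0, h2, h3, h4]
    push_cast
    split_ifs with h
    · have h' : (c : ℝ) + 1 ≤ P.k := by exact_mod_cast h
      rw [min_eq_right (by linarith), min_eq_right h', max_eq_left (by linarith),
        max_eq_left (by linarith)]
      ring
    · have h' : (P.k : ℝ) ≤ c := by exact_mod_cast not_lt.1 h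
      rw [min_eq_left h', min_eq_left (by linarith), max_eq_right (by linarith),
        max_eq_right (by linarith)]
      ring

theorem stepCost_input_nonneg (u : P.Layer) (j : ℕ) : 0 ≤ stepCost (P.input ε) u j := by
  have h2 : (P.input ε).real 2 u = P.α₁ u := by simp [input, u.2]
  have h3 : (P.input ε).real 3 u = P.α₂ u := by simp [input, u.2]
  have h4 : (P.input ε).real 4 u = P.α₃ u := by simp [input, u.2]
  rw [stepCost, h2, h3, h4]
  have := P.α₁_nonneg u
  have := P.α₁_le_α₂ u
  have := P.α₃_nonneg u
  split_ifs <;> linarith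

theorem energy_eq (W : P.Weights) :
    P.energy W = ∑ u : P.Layer, layerCost (P.input ε) u (P.l0 W u) + ∑ u, P.α₄ u := by
  rw [energy, ← Finset.sum_add_distrib]
  exact Finset.sum_congr rfl fun u _ => by rw [layerCost_input]

theorem layerCost_input_mono (u : P.Layer) {c d : ℕ} (h : c ≤ d) :
    layerCost (P.input ε) u c ≤ layerCost (P.input ε) u d :=
  layerCost_mono (P.stepCost_input_nonneg ε u) h

theorem sum_range_eq_sum_layer (f : ℕ → ℝ) :
    ∑ u ∈ Finset.range (P.numConv + P.numFC), f u = ∑ u : P.Layer, f u :=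
  Finset.sum_range f

theorem l0_le_size (W : P.Weights) (u : P.Layer) : P.l0 W u ≤ P.size u :=
  (Finset.card_filter_le _ _).trans (by simp)

theorem norm_sq_sub_eq (W : P.Weights) :
    ‖W - P.Z‖ ^ 2 = ∑ u : P.Layer, ∑ j : Fin (P.size u), (W ⟨u, j⟩ - P.Z ⟨u, j⟩) ^ 2 := by
  rw [EuclideanSpace.norm_sq_eq, Fintype.sum_sigma]
  simp

/-! ### The output is feasible and good -/

section Output

variable {P}

/-- With `c` nonzero weights in a layer, the squared distance to `Z` within the layer is at least the
sum of all squares minus the `c` largest ones. -/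
theorem norm_sq_sub_ge {u : P.Layer} {e : Equiv.Perm (Fin (P.size u))} {g : ℕ → ℝ}
    (hg : ∀ i : Fin (P.size u), g i = P.Z ⟨u, e i⟩ ^ 2)
    (hs : ∀ i j, i < j → j < P.size u → g j ≤ g i) (W : P.Weights) :
    ∑ j : Fin (P.size u), P.Z ⟨u, j⟩ ^ 2 - ∑ i ∈ Finset.range (P.l0 W u), g i ≤
      ∑ j : Fin (P.size u), (W ⟨u, j⟩ - P.Z ⟨u, j⟩) ^ 2 := by
  classical
  have h := Finset.sum_le_sum_range_card_of_sorted (z := fun j => P.Z ⟨u, j⟩ ^ 2) hg hs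
    (Finset.univ.filter fun j => W ⟨u, j⟩ ≠ 0)
  rw [Finset.sum_filter] at h
  have h' : ∑ j : Fin (P.size u), P.Z ⟨u, j⟩ ^ 2 ≤
      ∑ j : Fin (P.size u), (W ⟨u, j⟩ - P.Z ⟨u, j⟩) ^ 2 +
        ∑ j : Fin (P.size u), (if W ⟨u, j⟩ ≠ 0 then P.Z ⟨u, j⟩ ^ 2 else 0) := by
    rw [← Finset.sum_add_distrib]
    refine Finset.sum_le_sum fun j _ => ?_
    by_cases hW : W ⟨u, j⟩ = 0
    · simp [hW]
    · simp [hW, sq_nonneg]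
  have hl : P.l0 W u = (Finset.univ.filter fun j => W ⟨u, j⟩ ≠ 0).card := by
    simp only [l0]
  rw [hl]
  linarith

/-- If `W` agrees with `Z` at the first `c` positions of the order `e` and vanishes elsewhere in the
layer, then the lower bound of `norm_sq_sub_ge` is attained. -/
theorem norm_sq_sub_eq_of_prefix {u : P.Layer} {e : Equiv.Perm (Fin (P.size u))} {g : ℕ → ℝ}
    (hg : ∀ i : Fin (P.size u), g i = P.Z ⟨u, e i⟩ ^ 2) {c : ℕ} (hc : c ≤ P.size u)
    {W : P.Weights}
    (hW : ∀ j, W ⟨u, j⟩ = if (e.symm j : ℕ) < c then P.Z ⟨u, j⟩ else 0) :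
    P.l0 W u ≤ c ∧ ∑ j : Fin (P.size u), (W ⟨u, j⟩ - P.Z ⟨u, j⟩) ^ 2 =
      ∑ j : Fin (P.size u), P.Z ⟨u, j⟩ ^ 2 - ∑ i ∈ Finset.range c, g i := by
  classical
  constructor
  · rw [← Finset.card_range c]
    refine Finset.card_le_card_of_injOn (fun j => (e.symm j : ℕ)) (fun j hj => ?_)
      (fun i _ j _ hij => e.symm.injective (Fin.ext hij))
    rw [Finset.mem_coe, Finset.mem_filter, hW] at hj
    rw [Finset.coe_range, Set.mem_Iio]
    by_contra h
    exact hj.2 (if_neg h)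
  · rw [← Finset.sum_filter_symm_lt hc (z := fun j => P.Z ⟨u, j⟩ ^ 2) hg, Finset.sum_filter,
      ← Finset.sum_sub_distrib]
    refine Finset.sum_congr rfl fun j _ => ?_
    rw [hW]
    split_ifs <;> simp

end Output

theorem exec_program {ε : ℝ} (hε : 0 < ε) (hne : (P.Omega P.budget).Nonempty) {K Q : ℕ}
    (hK : K = ⌈1 / ε⌉₊) (hQ : Q = 1 + (P.numConv + P.numFC) * (K + 1)) :
    Exec program (P.input ε) (programTime (P.input ε) (P.numConv + P.numFC) K Q) fun τ =>
      P.output τ ∈ P.Omega P.budget ∧ ∀ W ∈ P.Omega (P.budget / (1 + ε)),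
        ‖P.output τ - P.Z‖ ^ 2 ≤ ‖W - P.Z‖ ^ 2 := by
  classical
  set σ := P.input ε with hσ
  have hlc0 : ∀ (u : P.Layer) c, 0 ≤ layerCost σ u c := fun u c =>
    Finset.sum_nonneg fun j _ => P.stepCost_input_nonneg ε u j
  have hα : ∑ u ∈ Finset.range (P.numConv + P.numFC), σ.real 5 u = ∑ u, P.α₄ u := by
    rw [sum_range_eq_sum_layer]
    exact Finset.sum_congr rfl fun u _ => by simp [hσ, input, u.2]
  have hα0 : 0 ≤ ∑ u, P.α₄ u := Finset.sum_nonneg fun u _ => P.α₄_nonneg u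
  have hB : P.budget - ∑ u, P.α₄ u = σ.real 0 0 -
      ∑ u ∈ Finset.range (P.numConv + P.numFC), σ.real 5 u := by
    rw [hα]; rfl
  have hB0 : 0 ≤ P.budget - ∑ u, P.α₄ u := by
    obtain ⟨W, hW⟩ := hne
    have h1 : P.energy W ≤ P.budget := hW
    rw [P.energy_eq ε] at h1
    have h2 : 0 ≤ ∑ u : P.Layer, layerCost σ u (P.l0 W u) :=
      Finset.sum_nonneg fun u _ => hlc0 u _
    linarith
  have hn : ∀ a, 10 ≤ a → σ.nat a 0 = 0 := by
    intro a ha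
    obtain ⟨b, rfl⟩ := Nat.exists_eq_add_of_le' ha
    rfl
  have hr : ∀ a, 10 ≤ a → σ.real a 0 = 0 := by
    intro a ha
    obtain ⟨b, rfl⟩ := Nat.exists_eq_add_of_le' ha
    rfl
  have hL : σ.nat 0 0 + σ.nat 0 1 = P.numConv + P.numFC := rfl
  refine (program_spec hε rfl hn hr (fun _ => rfl) (fun _ => rfl) hL hK hQ hB hB0
    (fun u hu j => P.stepCost_input_nonneg ε ⟨u, hu⟩ j)).mono le_rfl ?_
  rintro τ - ⟨order, M, hord, hcost, hopt, hout⟩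
  have hsize : ∀ u : P.Layer, σ.nat 1 u = P.size u := P.input_nat_size ε
  have hM : ∀ u : P.Layer, M u ≤ P.size u := fun u => by
    rw [← hsize]; exact (hord u u.2).2.2
  choose e he using fun u : P.Layer => exists_perm_of_slice_perm (m := P.size u) (by
    rw [← hsize]; exact (hord u u.2).1)
  have hg : ∀ (u : P.Layer) (i : Fin (P.size u)),
      weightSq (σ.real 1) (order (offset σ u + i)) = P.Z ⟨u, e u i⟩ ^ 2 := by
    intro u i
    rw [he, weightSq, P.input_real_weight ε ⟨u, e u i⟩, pow_two]
  -- Different layers occupy disjoint ranges of addresses, so only layer `u` writes to its cells.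
  have hW : ∀ (u : P.Layer) (j : Fin (P.size u)), P.output τ ⟨u, j⟩ =
      if ((e u).symm j : ℕ) < M u then P.Z ⟨u, j⟩ else 0 := by
    intro u j
    have h1 : P.output τ ⟨u, j⟩ = τ.real 6 (offset σ u + j) := by
      rw [P.offset_add ε ⟨u, j⟩]; rfl
    rw [h1, hout, P.input_real_weight ε ⟨u, j⟩]
    refine if_congr ⟨?_, fun h => ⟨u, u.2, _, h, ?_⟩⟩ rfl rfl
    · rintro ⟨v, hv, i, hi, hi'⟩
      have hi₂ : i < P.size ⟨v, hv⟩ := hi.trans_le (hM ⟨v, hv⟩)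
      have h2 : finSigmaFinEquiv (⟨⟨v, hv⟩, e ⟨v, hv⟩ ⟨i, hi₂⟩⟩ : P.Idx) =
          finSigmaFinEquiv (⟨u, j⟩ : P.Idx) := by
        refine Fin.ext ?_
        rw [← P.offset_add ε, ← P.offset_add ε]
        exact (he ⟨v, hv⟩ ⟨i, hi₂⟩).symm.trans hi'
      have h3 := finSigmaFinEquiv.injective h2
      rw [Sigma.mk.injEq] at h3
      obtain ⟨rfl, h4⟩ := h3
      rw [← eq_of_heq h4, Equiv.symm_apply_apply]
      exact hi
    · rw [he, Equiv.apply_symm_apply]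
  have hout' : ∀ u : P.Layer, P.l0 (P.output τ) u ≤ M u ∧
      ∑ j : Fin (P.size u), (P.output τ ⟨u, j⟩ - P.Z ⟨u, j⟩) ^ 2 =
        ∑ j : Fin (P.size u), P.Z ⟨u, j⟩ ^ 2 - layerGain σ order u (M u) := fun u =>
    norm_sq_sub_eq_of_prefix (g := fun i => weightSq (σ.real 1) (order (offset σ u + i)))
      (hg u) (hM u) (hW u)
  refine ⟨?_, fun W hWΩ => ?_⟩
  · change P.energy _ ≤ _
    rw [P.energy_eq ε]
    rw [sum_range_eq_sum_layer P fun u => layerCost σ u (M u)] at hcost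
    have : ∑ u : P.Layer, layerCost σ u (P.l0 (P.output τ) u) ≤
        ∑ u : P.Layer, layerCost σ u (M u) :=
      Finset.sum_le_sum fun u _ => P.layerCost_input_mono ε u (hout' u).1
    linarith
  · let M' : ℕ → ℕ := fun u => if h : u < P.numConv + P.numFC then P.l0 W ⟨u, h⟩ else 0
    have hM' : ∀ u : P.Layer, M' u = P.l0 W u := fun u => dif_pos u.2
    have h1 := hopt M' (fun u hu => by
      rw [hsize ⟨u, hu⟩, hM' ⟨u, hu⟩]
      exact P.l0_le_size W _) (by
        rw [sum_range_eq_sum_layer P fun u => layerCost σ u (M' u),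
          Finset.sum_congr rfl fun u _ => by rw [hM' u]]
        have h2 : P.energy W ≤ P.budget / (1 + ε) := hWΩ
        rw [P.energy_eq ε, le_div_iff₀ (by linarith)] at h2
        nlinarith)
    rw [sum_range_eq_sum_layer P fun u => layerGain σ order u (M' u),
      sum_range_eq_sum_layer P fun u => layerGain σ order u (M u),
      Finset.sum_congr rfl fun u _ => by rw [hM' u]] at h1
    have h3 : ∀ u : P.Layer, ∑ j : Fin (P.size u), P.Z ⟨u, j⟩ ^ 2 -
        layerGain σ order u (P.l0 W u) ≤
          ∑ j : Fin (P.size u), (W ⟨u, j⟩ - P.Z ⟨u, j⟩) ^ 2 := fun u =>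
      norm_sq_sub_ge (g := fun i => weightSq (σ.real 1) (order (offset σ u + i))) (hg u)
        (by rw [← hsize]; exact (hord u u.2).2.1) W
    rw [norm_sq_sub_eq, norm_sq_sub_eq, Finset.sum_congr rfl fun u _ => (hout' u).2]
    refine le_trans ?_ (Finset.sum_le_sum fun u _ => h3 u)
    rw [Finset.sum_sub_distrib, Finset.sum_sub_distrib]
    linarith

/-! ### The running time -/

theorem minPosA_pos (h : ∃ x, 0 < P.A x) : 0 < P.minPosA ∧ P.minPosA ≤ P.maxA := by
  have hfin : {a | 0 < a ∧ ∃ x, P.A x = a}.Finite :=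
    (Set.finite_range P.A).subset fun a ⟨_, x, hx⟩ => ⟨x, hx⟩
  obtain ⟨x, hx⟩ := h
  have hmem : P.minPosA ∈ {a | 0 < a ∧ ∃ x, P.A x = a} :=
    Set.Nonempty.csInf_mem ⟨P.A x, hx, x, rfl⟩ hfin
  obtain ⟨h1, y, hy⟩ := hmem
  refine ⟨h1, ?_⟩
  rw [← hy]
  exact le_ciSup (Set.finite_range P.A).bddAbove y

/-- The logarithm in the running time is at least the one that sorting costs. -/
theorem log_le_log_ratio (hn : 2 ≤ P.n) (h : ∃ x, 0 < P.A x) :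
    Real.log P.n ≤ Real.log (P.n * P.maxA / P.minPosA) := by
  obtain ⟨h1, h2⟩ := P.minPosA_pos h
  have hn' : (0 : ℝ) < P.n := by
    exact_mod_cast (by omega : 0 < P.n)
  refine Real.log_le_log hn' ?_
  rw [le_div_iff₀ h1]
  exact mul_le_mul_of_nonneg_left h2 hn'.le

theorem clog_le_log {n : ℕ} (hn : 2 ≤ n) : (Nat.clog 2 n : ℝ) ≤ 4 * Real.log n := by
  have h2 := Real.log_two_gt_d9
  have hn' : (0 : ℝ) < n := by exact_mod_cast (by omega : 0 < n)
  have h1 : 2 ^ (Nat.clog 2 n).pred < n := Nat.pow_pred_clog_lt_self (by norm_num) hn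
  have h1' : (2 : ℝ) ^ (Nat.clog 2 n).pred ≤ n := by exact_mod_cast h1.le
  have h3 := Real.log_le_log (by positivity) h1'
  rw [Real.log_pow] at h3
  have h4 : (Nat.clog 2 n : ℝ) ≤ (Nat.clog 2 n).pred + 1 := by
    have : Nat.clog 2 n ≤ (Nat.clog 2 n).pred + 1 := by rw [Nat.pred_eq_sub_one]; omega
    exact_mod_cast this
  have h5 : Real.log 2 ≤ Real.log n := Real.log_le_log (by norm_num) (by exact_mod_cast hn)
  have h6 : (0 : ℝ) ≤ (Nat.clog 2 n).pred := Nat.cast_nonneg _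
  nlinarith

theorem programTime_le (ε : ℝ) (K Q : ℕ) :
    programTime (P.input ε) (P.numConv + P.numFC) K Q ≤
      100 * K + 500 + Nat.clog 2 P.n * (500 * P.n + 250 * (P.numConv + P.numFC)) + 600 * P.n +
        (P.numConv + P.numFC) * (1000 * (Q + 2) ^ 2 + 1330) := by
  have hsum : ∑ u ∈ Finset.range (P.numConv + P.numFC), (P.input ε).nat 1 u = P.n := by
    rw [Finset.sum_range]
    exact Finset.sum_congr rfl fun u _ => P.input_nat_size ε u
  have h1 : ∑ u ∈ Finset.range (P.numConv + P.numFC),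
      (layerTime Q ((P.input ε).nat 1 u) + 20) ≤
      ∑ u ∈ Finset.range (P.numConv + P.numFC), (Nat.clog 2 P.n *
        (500 * (P.input ε).nat 1 u + 250) + 500 * (P.input ε).nat 1 u +
          (1000 * (Q + 2) ^ 2 + 1020)) := by
    refine Finset.sum_le_sum fun u hu => ?_
    have h2 : (P.input ε).nat 1 u ≤ P.n := by
      rw [← hsum]
      exact Finset.single_le_sum (fun _ _ => Nat.zero_le _) hu
    have h3 := Nat.mul_le_mul_right (500 * (P.input ε).nat 1 u + 250) (Nat.clog_mono_right 2 h2)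
    rw [layerTime]
    linarith
  rw [programTime]
  refine (Nat.add_le_add_left (Nat.add_le_add_right h1 _) _).trans (le_of_eq ?_)
  simp only [Finset.sum_add_distrib, ← Finset.mul_sum, hsum, Finset.sum_const, Finset.card_range,
    smul_eq_mul]
  ring

/-- The running time in terms of the size of the problem: sorting takes `n log n` steps, and the
dynamic program takes `|U ∪ V|` times the square of `O(|U ∪ V| / ε)` quanta. -/
theorem programTime_le_log {ε : ℝ} (hε : 0 < ε) (hε1 : ε ≤ 1) {K Q : ℕ}
    (hK : K = ⌈1 / ε⌉₊) (hQ : Q = 1 + (P.numConv + P.numFC) * (K + 1))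
    (hn : 2 ≤ P.n) (hA : ∃ x, 0 < P.A x) :
    (programTime (P.input ε) (P.numConv + P.numFC) K Q : ℝ) ≤
      100000 * (((P.n : ℝ) + ((P.numConv : ℝ) + (P.numFC : ℝ)) ^ 3 / ε ^ 2) *
        Real.log ((P.n : ℝ) * P.maxA / P.minPosA)) := by
  set l := Real.log ((P.n : ℝ) * P.maxA / P.minPosA) with hl
  have hlog := P.log_le_log_ratio hn hA
  have hL1 : 1 ≤ P.numConv + P.numFC := by
    by_contra h
    have : P.n = 0 := by
      have : IsEmpty P.Layer := ⟨fun u => by have := u.2; omega⟩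
      exact Finset.sum_of_isEmpty _
    omega
  have hT := P.programTime_le ε K Q
  generalize hLdef : P.numConv + P.numFC = L at hT hL1 hQ ⊢
  have hLr : (P.numConv : ℝ) + (P.numFC : ℝ) = L := by rw [← hLdef]; push_cast; ring
  rw [hLr]
  generalize programTime (P.input ε) L K Q = T at hT ⊢
  have hc := clog_le_log hn
  have h2 := Real.log_two_gt_d9
  have h2n : Real.log 2 ≤ Real.log P.n := Real.log_le_log (by norm_num) (by exact_mod_cast hn)
  have hl1 : 1 ≤ 2 * l := by linarith
  have hcl : (Nat.clog 2 P.n : ℝ) ≤ 4 * l := by linarith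
  generalize Nat.clog 2 P.n = c at hT hcl
  have hL1' : (1 : ℝ) ≤ L := by exact_mod_cast hL1
  obtain ⟨y, hy⟩ : ∃ y, y = 1 / ε := ⟨_, rfl⟩
  have hy1 : 1 ≤ y := by rw [hy, le_div_iff₀ hε]; linarith
  have hKy : (K : ℝ) ≤ 2 * y := by
    have := Nat.ceil_lt_add_one (R := ℝ) (a := 1 / ε) (by positivity)
    rw [← hK, ← hy] at this
    linarith
  have hX : (L : ℝ) ^ 3 / ε ^ 2 = L * (L * y) ^ 2 := by
    rw [hy]; field_simp
  have hLy1 : L ≤ L * y := le_mul_of_one_le_right (by linarith) hy1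
  have hLy2 : y ≤ L * y := le_mul_of_one_le_left (by linarith) hL1'
  have hQy : (Q : ℝ) + 2 ≤ 6 * (L * y) := by
    rw [hQ]
    push_cast
    nlinarith
  rw [hX]
  generalize hw : (L : ℝ) * y = w at *
  have hw1 : 1 ≤ w := by linarith
  have hw2 : w ≤ w ^ 2 := by nlinarith
  have hQ2 : ((Q : ℝ) + 2) ^ 2 ≤ 36 * w ^ 2 := by
    have : (0 : ℝ) ≤ (Q : ℝ) + 2 := by positivity
    nlinarith
  have hwX : w ^ 2 ≤ L * w ^ 2 := le_mul_of_one_le_left (by positivity) hL1'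
  have hLX : (L : ℝ) ≤ L * w ^ 2 := le_mul_of_one_le_right (by linarith) (by linarith)
  have hLQ : (L : ℝ) * ((Q : ℝ) + 2) ^ 2 ≤ 36 * (L * w ^ 2) := by
    have := mul_le_mul_of_nonneg_left hQ2 (by linarith : (0 : ℝ) ≤ L)
    linarith
  generalize (L : ℝ) * w ^ 2 = X at *
  have hT' : (T : ℝ) ≤ 100 * K + 500 + c * (500 * P.n + 250 * L) + 600 * P.n +
      L * (1000 * (Q + 2) ^ 2 + 1330) := by exact_mod_cast hT
  have hn0 : (0 : ℝ) ≤ P.n := Nat.cast_nonneg _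
  have hX0 : 0 ≤ X := by linarith
  have h3 : (c : ℝ) * (500 * P.n + 250 * L) ≤ 4 * l * (500 * P.n + 250 * X) :=
    mul_le_mul hcl (by linarith) (by positivity) (by linarith)
  have h4 : (P.n : ℝ) ≤ P.n * (2 * l) := le_mul_of_one_le_right hn0 hl1
  have h5 : X ≤ X * (2 * l) := le_mul_of_one_le_right hX0 hl1
  have h6 : 0 ≤ P.n * l := mul_nonneg hn0 (by linarith)
  have h7 : 0 ≤ X * l := mul_nonneg hX0 (by linarith)
  linarith

end EnergyProblem

theorem theorem3 :
    ∃ (p : RealRAM.Prog) (c C : ℝ) (D : ℕ → ℝ), 0 < c ∧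
      ∀ (P : EnergyProblem) (ε : ℝ), 0 < ε → ε ≤ 1 → (P.Omega P.budget).Nonempty →
        ∃ (T : ℕ) (σ : RealRAM.Memory), RealRAM.Run p (P.input ε) T σ ∧
          P.output σ ∈ P.Omega P.budget ∧
          (∀ Q : P.Weights, P.IsProjection (P.Omega (P.budget / (1 + c * ε))) Q →
            ‖P.output σ - P.Z‖ ^ 2 ≤ ‖Q - P.Z‖ ^ 2) ∧
          (2 ≤ P.n → (∃ x, 0 < P.A x) →
            (T : ℝ) ≤ C * (((P.n : ℝ) + ((P.numConv : ℝ) + (P.numFC : ℝ)) ^ 3 / ε ^ 2) *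
              Real.log ((P.n : ℝ) * P.maxA / P.minPosA)) ∧
            (T : ℝ) ≤ D (P.numConv + P.numFC) * (((P.n : ℝ) + 1 / ε ^ 2) *
              Real.log ((P.n : ℝ) * P.maxA / P.minPosA))) := by
  refine ⟨RealRAM.Projection.program, 1, 100000, fun L => 100000 * (1 + (L : ℝ) ^ 3), one_pos,
    fun P ε hε hε1 hne => ?_⟩
  obtain ⟨T, σ, hrun, hT, hmem, hopt⟩ := P.exec_program hε hne rfl rfl
  refine ⟨T, σ, hrun, hmem, fun Q hQ => hopt Q (by simpa using hQ.1), fun hn hA => ?_⟩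
  have h1 := (Nat.cast_le (α := ℝ)).2 hT |>.trans (P.programTime_le_log hε hε1 rfl rfl hn hA)
  refine ⟨h1, h1.trans ?_⟩
  have hlog : 0 ≤ Real.log ((P.n : ℝ) * P.maxA / P.minPosA) :=
    (Real.log_natCast_nonneg _).trans (P.log_le_log_ratio hn hA)
  rw [mul_assoc 100000 (1 + _)]
  refine mul_le_mul_of_nonneg_left ?_ (by norm_num)
  rw [← mul_assoc]
  refine mul_le_mul_of_nonneg_right ?_ hlog
  push_cast
  have h3 : (0 : ℝ) ≤ ((P.numConv : ℝ) + P.numFC) ^ 3 := by positivity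
  have h4 : (0 : ℝ) ≤ ((P.numConv : ℝ) + P.numFC) ^ 3 * P.n := by positivity
  have h5 : (0 : ℝ) ≤ 1 / ε ^ 2 := by positivity
  rw [div_eq_mul_one_div]
  linarith
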